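/- Let $k$ be a field. A filtered simplicial complex is a sequence $X_0\subseteq X_1\subseteq X_2\subseteq\cdots$ of abstract simplicial complexes on a common vertex set (neither the complexes nor the filtration need be finite). Fix a total order on the vertices. For $q\ge 0$ let $C_q(X)$ be the free graded $k[t]$-module with one generator for each $q$-simplex $\sigma$ of $\bigcup_n X_n$, placed in degree $\operatorname{birth}(\sigma)=\min\{n:\sigma\in X_n\}$, with the boundary map $$\partial\{v_0<\dots<v_q\}=\sum_{i=0}^{q}(-1)^i\,t^{\operatorname{birth}(\sigma)-\operatorname{birth}(\sigma\setminus v_i)}\,(\sigma\setminus v_i)\qquad(q\ge 1),$$ where $\sigma=\{v_0<\dots<v_q\}$, and $\partial=0$ on $C_0(X)$. The persistent homology $H_q(X)$ is the homology of this complex, a graded $k[t]$-module. Call $X$ persistently acyclic if $H_0(X)$ is free over $k[t]$ on one homogeneous generator and $H_q(X)=0$ for all $q\ge 1$. Theorem (Persistent homology Nerve lemma). Let $X$ be a filtered simplicial complex covered by a family $(U_i)_{i\in I}$ of filtered subcomplexes, $X=\bigcup_i U_i$, that is, $X_n=\bigcup_i (U_i)_n$ for every $n$. Let $I$ be totally ordered.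 For finite nonempty $J\subseteq I$ let $U_J=\bigcap_{j\in J}U_j$ be the filtered complex with $(U_J)_n=\bigcap_{j\in J}(U_j)_n$, and suppose that every such $U_J$ which is nonempty (that is, $(U_J)_n\neq\emptyset$ for some $n$) is persistently acyclic. Let $\mathcal N(\mathcal U)$ be the filtered nerve, whose simplices at step $n$ are the finite nonempty $J\subseteq I$ with $(U_J)_n\ne\emptyset$. Then for every $q\ge 0$ there is an isomorphism of graded $k[t]$-modules (of degree $0$) $$H_q(X)\;\cong\;H_q(\mathcal N(\mathcal U)).$$ -/

import Mathlib

/-- A filtered simplicial complex `X 0 ⊆ X 1 ⊆ X 2 ⊆ ⋯` whose vertices lie in `V`; a finite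
filtration is one which is eventually constant.  The order is inclusion at every filtration step,
and suprema and infima are unions and intersections at every filtration step. -/
abbrev FilteredComplex (V : Type*) := ℕ →o PreAbstractSimplicialComplex V

namespace FilteredComplex

variable {V I : Type*}

/-- The `q`-simplices of (the union of) a filtered complex. -/
def Simplex (X : FilteredComplex V) (q : ℕ) : Type _ :=
  {σ : Finset V // (∃ n, σ ∈ X n) ∧ σ.card = q + 1}

/-- The filtration step at which a simplex enters. -/
noncomputable def birth {X : FilteredComplex V} {q : ℕ} (σ : X.Simplex q) : ℕ :=
  sInf {n | σ.1 ∈ X n}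

theorem mem_iff_birth_le {X : FilteredComplex V} {q : ℕ} (σ : X.Simplex q) (n : ℕ) :
    σ.1 ∈ X n ↔ birth σ ≤ n := by
  refine ⟨fun h => Nat.sInf_le h, fun h => ?_⟩
  have h0 : σ.1 ∈ X (birth σ) := Nat.sInf_mem (s := {n | σ.1 ∈ X n}) σ.2.1
  exact X.monotone h h0

/-- The intersection of the filtered complexes `U j`, `j ∈ J`. -/
def inter (U : I → FilteredComplex V) (J : Finset I) : FilteredComplex V := ⨅ j ∈ J, U j

theorem mem_inter (U : I → FilteredComplex V) {J : Finset I} (hJ : J.Nonempty) (n : ℕ)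
    (σ : Finset V) : σ ∈ inter U J n ↔ ∀ j ∈ J, σ ∈ U j n := by
  have hle : ∀ j ∈ J, inter U J n ≤ U j n := fun j hj =>
    (iInf₂_le j hj : inter U J ≤ U j) n
  refine ⟨fun h j hj => hle j hj h, fun h => ?_⟩
  obtain ⟨j₀, hj₀⟩ := hJ
  simp only [inter, OrderHom.iInf_apply]
  refine ⟨?_, ((U j₀ n).isRelLowerSet_faces (h j₀ hj₀)).1⟩
  simp only [Set.mem_iInter]
  rintro K ⟨j, rfl⟩
  refine ⟨?_, ((U j₀ n).isRelLowerSet_faces (h j₀ hj₀)).1⟩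
  simp only [Set.mem_iInter]
  rintro K ⟨hj, rfl⟩
  exact h j hj

theorem mem_iSup (U : I → FilteredComplex V) (n : ℕ) (σ : Finset V) :
    σ ∈ (⨆ i, U i) n ↔ ∃ i, σ ∈ U i n := by
  rw [OrderHom.iSup_apply]
  change σ ∈ (⋃ K ∈ Set.range fun i => U i n, K.faces) ↔ _
  simp only [Set.mem_iUnion, Set.mem_range]
  constructor
  · rintro ⟨_, ⟨i, rfl⟩, h⟩
    exact ⟨i, h⟩
  · rintro ⟨i, h⟩
    exact ⟨_, ⟨i, rfl⟩, h⟩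

/-- The filtered nerve: at step `n` its simplices are the finite nonempty `J` for which the
intersection of the `U j`, `j ∈ J`, is nonempty at step `n`. -/
def nerve (U : I → FilteredComplex V) : FilteredComplex I where
  toFun n :=
    { faces := {J | J.Nonempty ∧ ∃ σ, σ ∈ inter U J n}
      isRelLowerSet_faces := by
        rintro J ⟨hJ, σ, hσ⟩
        refine ⟨hJ, fun J' hJ' hne => ⟨hne, σ, ?_⟩⟩
        rw [mem_inter U hne]
        rw [mem_inter U hJ] at hσ
        exact fun j hj => hσ j (hJ' hj) }
  monotone' := by
    rintro m n hmn J ⟨hJ, σ, hσ⟩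
    exact ⟨hJ, σ, (inter U J).monotone hmn hσ⟩

section Homology

variable (k : Type*) [Field k]

/-- The persistence chain module: the free `k[t]`-module with one generator for each `q`-simplex. -/
abbrev Chains (X : FilteredComplex V) (q : ℕ) : Type _ := X.Simplex q →₀ Polynomial k

/-- The homogeneous chains of degree `n`, where the generator of a simplex has the degree at which
the simplex enters: the `k`-span of all `t ^ m • σ` with `birth σ + m = n`. -/
noncomputable def chainsDegree (X : FilteredComplex V) (q n : ℕ) : Submodule k (Chains k X q) :=
  Submodule.span k {c | ∃ (σ : X.Simplex q) (m : ℕ),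
    birth σ + m = n ∧ c = Finsupp.single σ ((Polynomial.X : Polynomial k) ^ m)}

variable [LinearOrder V]

/-- The face of a simplex opposite to one of its vertices. -/
def face {X : FilteredComplex V} {q : ℕ} (σ : X.Simplex (q + 1)) (v : V) (hv : v ∈ σ.1) :
    X.Simplex q :=
  ⟨σ.1.erase v, by
    have hcard : (σ.1.erase v).card = q + 1 := by
      rw [Finset.card_erase_of_mem hv, σ.2.2, Nat.add_sub_cancel]
    obtain ⟨n, hn⟩ := σ.2.1
    refine ⟨⟨n, ((X n).isRelLowerSet_faces hn).2 (Finset.erase_subset v σ.1) ?_⟩, hcard⟩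
    exact Finset.card_pos.mp (by omega)⟩

theorem birth_face_le {X : FilteredComplex V} {q : ℕ} (σ : X.Simplex (q + 1)) (v : V)
    (hv : v ∈ σ.1) : birth (face σ v hv) ≤ birth σ := by
  rw [← mem_iff_birth_le]
  have h := (mem_iff_birth_le σ (birth σ)).2 le_rfl
  refine ((X (birth σ)).isRelLowerSet_faces h).2 (Finset.erase_subset v σ.1) ?_
  exact Finset.card_pos.mp (by rw [(face σ v hv).2.2]; omega)

/-- The position of `v` among the vertices of `σ` in increasing order. -/
def position (σ : Finset V) (v : V) : ℕ := (σ.filter (· < v)).card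

/-- The boundary of the generator of `σ = {v₀ < ⋯ < v_{q+1}}`, which is
`∑ i, (-1) ^ i • t ^ (birth σ - birth (σ \ vᵢ)) • (σ \ vᵢ)`. -/
noncomputable def boundarySimplex {X : FilteredComplex V} {q : ℕ} (σ : X.Simplex (q + 1)) :
    Chains k X q :=
  ∑ v ∈ σ.1.attach, Finsupp.single (face σ v.1 v.2)
    ((-1) ^ position σ.1 v.1 * (Polynomial.X : Polynomial k) ^ (birth σ - birth (face σ v.1 v.2)))

/-- The `k[t]`-linear boundary map of the persistence complex. -/
noncomputable def boundary (X : FilteredComplex V) (q : ℕ) :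
    Chains k X (q + 1) →ₗ[Polynomial k] Chains k X q :=
  Finsupp.linearCombination (Polynomial k) (boundarySimplex k)

/-- Cycles: every `0`-chain is a cycle. -/
noncomputable def cycles (X : FilteredComplex V) : (q : ℕ) → Submodule (Polynomial k) (Chains k X q)
  | 0 => ⊤
  | q + 1 => LinearMap.ker (boundary k X q)

theorem position_erase_of_le {σ : Finset V} {v w : V} (h : w ≤ v) :
    position (σ.erase v) w = position σ w := by
  unfold position
  congr 1
  ext x
  simp only [Finset.mem_filter, Finset.mem_erase]
  exact ⟨fun hx => ⟨hx.1.2, hx.2⟩, fun hx => ⟨⟨(hx.2.trans_le h).ne, hx.1⟩, hx.2⟩⟩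

theorem position_erase_of_lt {σ : Finset V} {v w : V} (hv : v ∈ σ) (h : v < w) :
    position (σ.erase v) w + 1 = position σ w := by
  unfold position
  rw [← Finset.card_erase_add_one (s := σ.filter (· < w)) (Finset.mem_filter.2 ⟨hv, h⟩)]
  congr 2
  ext x
  simp only [Finset.mem_filter, Finset.mem_erase]
  tauto

theorem boundary_boundarySimplex {X : FilteredComplex V} {q : ℕ} (σ : X.Simplex (q + 1 + 1)) :
    boundary k X q (boundarySimplex k σ) = 0 := by
  have hterm : ∀ (v : V) (hv : v ∈ σ.1) (w : V) (hw : w ∈ (face σ v hv).1),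
      ((-1) ^ position σ.1 v *
        (Polynomial.X : Polynomial k) ^ (birth σ - birth (face σ v hv))) •
      Finsupp.single (face (face σ v hv) w hw) ((-1) ^ position (face σ v hv).1 w *
        (Polynomial.X : Polynomial k) ^
          (birth (face σ v hv) - birth (face (face σ v hv) w hw))) =
      Finsupp.single (face (face σ v hv) w hw)
        ((-1) ^ (position σ.1 v + position (σ.1.erase v) w) *
          (Polynomial.X : Polynomial k) ^ (birth σ - birth (face (face σ v hv) w hw))) := by
    intro v hv w hw
    rw [Finsupp.smul_single, smul_eq_mul, mul_mul_mul_comm, ← pow_add, ← pow_add]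
    have h1 := birth_face_le σ v hv
    have h2 := birth_face_le (face σ v hv) w hw
    congr 3
    omega
  simp only [boundarySimplex, boundary, map_sum, Finsupp.linearCombination_single,
    Finset.smul_sum, hterm]
  rw [Finset.sum_sigma']
  have hmem : ∀ a : (v : {v // v ∈ σ.1}) × {w // w ∈ (face σ v.1 v.2).1},
      a.2.1 ∈ σ.1 ∧ a.1.1 ∈ σ.1.erase a.2.1 := by
    rintro ⟨⟨v, hv⟩, ⟨w, hw⟩⟩
    have hw' : w ∈ σ.1.erase v := hw
    rw [Finset.mem_erase] at hw'
    exact ⟨hw'.2, Finset.mem_erase.2 ⟨hw'.1.symm, hv⟩⟩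
  refine Finset.sum_involution
    (fun a _ => ⟨⟨a.2.1, (hmem a).1⟩, ⟨a.1.1, (hmem a).2⟩⟩) ?_ ?_ ?_ ?_
  · rintro ⟨⟨v, hv⟩, ⟨w, hw⟩⟩ -
    have hw' : w ∈ σ.1.erase v := hw
    rw [Finset.mem_erase] at hw'
    have hv' : v ∈ σ.1.erase w := Finset.mem_erase.2 ⟨hw'.1.symm, hv⟩
    have hface : face (face σ w hw'.2) v hv' = face (face σ v hv) w hw :=
      Subtype.ext (Finset.erase_right_comm)
    change Finsupp.single (face (face σ v hv) w hw) _ +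
      Finsupp.single (face (face σ w hw'.2) v hv') _ = 0
    simp only [hface]
    rw [← Finsupp.single_add, ← add_mul]
    have hsign : ((-1 : Polynomial k) ^ (position σ.1 v + position (σ.1.erase v) w) +
        (-1) ^ (position σ.1 w + position (σ.1.erase w) v)) = 0 := by
      rcases lt_or_gt_of_ne hw'.1 with h | h
      · rw [position_erase_of_le h.le, ← position_erase_of_lt hw'.2 h]
        ring
      · rw [position_erase_of_le h.le, ← position_erase_of_lt hv h]
        ring
    rw [hsign, zero_mul, Finsupp.single_zero]
  · rintro ⟨⟨v, hv⟩, ⟨w, hw⟩⟩ - - heq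
    have h1 : w = v := congrArg (fun a => a.1.1) heq
    have hw' : w ∈ σ.1.erase v := hw
    exact Finset.ne_of_mem_erase hw' h1
  · intro a _
    simp
  · rintro ⟨⟨v, hv⟩, ⟨w, hw⟩⟩ -
    rfl

theorem boundary_comp_boundary (X : FilteredComplex V) (q : ℕ) :
    boundary k X q ∘ₗ boundary k X (q + 1) = 0 := by
  ext1 σ
  refine LinearMap.ext_ring ?_
  simp only [LinearMap.comp_apply, Finsupp.lsingle_apply, LinearMap.zero_apply]
  rw [boundary.eq_def k X (q + 1), Finsupp.linearCombination_single, one_smul]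
  exact boundary_boundarySimplex k σ

theorem range_boundary_le_cycles (X : FilteredComplex V) (q : ℕ) :
    LinearMap.range (boundary k X q) ≤ cycles k X q := by
  cases q with
  | zero => exact le_top
  | succ q => exact LinearMap.range_le_ker_iff.2 (boundary_comp_boundary k X q)

noncomputable instance (X : FilteredComplex V) (q : ℕ)
    (p : Submodule (Polynomial k) (Chains k X q)) : AddCommGroup p :=
  inferInstance

/-- Persistent homology in degree `q`, a `k[t]`-module: cycles modulo boundaries. -/
abbrev Homology (X : FilteredComplex V) (q : ℕ) : Type _ :=
  ↥(cycles k X q) ⧸ (LinearMap.range (boundary k X q)).submoduleOf (cycles k X q)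

/-- The degree `n` part of the graded `k[t]`-module `Homology k X q`: the classes of homogeneous
cycles of degree `n`. -/
noncomputable def homologyDegree (X : FilteredComplex V) (q n : ℕ) : Submodule k (Homology k X q) :=
  ((chainsDegree k X q n).comap ((cycles k X q).subtype.restrictScalars k)).map
    (((LinearMap.range (boundary k X q)).submoduleOf (cycles k X q)).mkQ.restrictScalars k)

/-- Persistent homology is `k[t]`-free on one homogeneous generator in homological degree `0`, and
vanishes in all higher homological degrees. -/
def PersistentlyAcyclic (X : FilteredComplex V) : Prop :=
  (∃ (b : Module.Basis Unit (Polynomial k) (Homology k X 0)) (n : ℕ), b () ∈ homologyDegree k X 0 n) ∧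
    ∀ q : ℕ, Subsingleton (Homology k X (q + 1))

end Homology

end FilteredComplex

/-! Both `X` and the nerve sit as full subcomplexes in one filtered complex, the blowup `Z` on the
disjoint union of `V` and `I`. Its simplices at step `n` are the nonempty subsets of σ ⊔ J, where σ
and J are nonempty and σ lies in every `U j`, j ∈ J, at step `n`. The subsets of `V` among them form
`X`, those of `I` form the nerve, and each inclusion is shown to induce a graded isomorphism in
homology.

Both isomorphisms come from one principle (`exists_homology_equiv`). For an inclusion `f` of
vertices, the outer part of a simplex is what lies outside the range of `f`. If every nonempty outer
set `J` has an exact augmented link, a chain whose boundary is inside the subcomplex can be pushed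
inside by subtracting a boundary. The components with the largest outer parts `J` are cycles in the
links of those `J`. Filling them and subtracting the boundary leaves only smaller outer parts, and
only finitely many rounds are needed (`exists_sub_augBoundary_outerPart_eq_empty`).

For `X`, the link of `J` is the intersection of the `U j`, exact by persistent acyclicity
(`augExact_of_persistentlyAcyclic`). For the nerve, the link of σ is a cone whose apex is an index
`i` with σ ∈ `U i` as soon as σ is born (`augExact_of_cone`). In both links the empty set has the
degree of the outer set. All chains are treated as chains on arbitrary finite sets, the empty set
included, so that links and the augmentation need no separate formalism. -/

namespace FilteredComplex

open Polynomial

/-! ### Graded chains on finite sets, augmented boundary and cones -/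

section AugmentedBoundary

variable {k : Type*} [Field k] {V : Type*}

/-- Chains supported on `s` are sums of multiples of generators in `s`. -/
theorem supported_induction {s : Set (Finset V)}
    {p : (c : Finset V →₀ k[X]) → c ∈ Finsupp.supported k[X] k[X] s → Prop}
    (h0 : p 0 (zero_mem _))
    (hadd : ∀ c hc d hd, p c hc → p d hd → p (c + d) (add_mem hc hd))
    (hsingle : ∀ σ (hσ : σ ∈ s) r, p (Finsupp.single σ r) (Finsupp.single_mem_supported _ _ hσ))
    {c : Finset V →₀ k[X]} (hc : c ∈ Finsupp.supported k[X] k[X] s) : p c hc := by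
  suffices h : ∃ h, p c h from h.2
  rw [← Finsupp.sum_single c]
  exact Finset.sum_induction _ (fun c => ∃ h, p c h)
    (fun c d hc hd => ⟨_, hadd c hc.1 d hd.1 hc.2 hd.2⟩) ⟨_, h0⟩
    fun σ hσ => ⟨_, hsingle σ (hc hσ) _⟩

/-- The homogeneous chains of degree `n`. -/
def homogeneousChains (k : Type*) [Field k] (b : Finset V → ℕ) (n : ℕ) :
    Submodule k (Finset V →₀ k[X]) where
  carrier := {c | ∀ σ m, (c σ).coeff m ≠ 0 → b σ + m = n}
  zero_mem' := by simp
  add_mem' := by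
    intro c d hc hd σ m h
    by_contra hne
    have h1 := not_imp_comm.1 (hc σ m) hne
    have h2 := not_imp_comm.1 (hd σ m) hne
    simp [h1, h2] at h
  smul_mem' := by
    intro a c hc σ m h
    refine hc σ m fun h0 => h ?_
    simp [h0]

theorem mem_homogeneousChains {b : Finset V → ℕ} {n : ℕ} {c : Finset V →₀ k[X]} :
    c ∈ homogeneousChains k b n ↔ ∀ σ m, (c σ).coeff m ≠ 0 → b σ + m = n :=
  Iff.rfl

/-- The projection of chains onto their homogeneous parts of degree `n`. -/
noncomputable def homogeneousPart (k : Type*) [Field k] (b : Finset V → ℕ) (n : ℕ) :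
    (Finset V →₀ k[X]) →ₗ[k] (Finset V →₀ k[X]) :=
  Finsupp.lsum k fun σ => Finsupp.lsingle σ ∘ₗ
    (if b σ ≤ n then (monomial (n - b σ)) ∘ₗ lcoeff k (n - b σ) else 0)

theorem coeff_homogeneousPart (b : Finset V → ℕ) (n : ℕ) (c : Finset V →₀ k[X]) (σ : Finset V)
    (m : ℕ) : (homogeneousPart k b n c σ).coeff m =
      if b σ + m = n then (c σ).coeff m else 0 := by
  induction c using Finsupp.induction_linear with
  | zero => simp
  | add c d hc hd =>
    rw [map_add, Finsupp.add_apply, coeff_add, hc, hd, Finsupp.add_apply, coeff_add]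
    split_ifs <;> simp
  | single τ r =>
    rw [homogeneousPart, Finsupp.lsum_single, LinearMap.comp_apply, Finsupp.lsingle_apply]
    rcases eq_or_ne τ σ with rfl | hne
    · rw [Finsupp.single_eq_same, Finsupp.single_eq_same]
      split_ifs with h1 h2 h2
      · rw [LinearMap.comp_apply, lcoeff_apply, coeff_monomial, if_pos (by omega)]
        congr 1
        omega
      · rw [LinearMap.comp_apply, lcoeff_apply, coeff_monomial, if_neg (by omega)]
      · omega
      · simp
    · rw [Finsupp.single_eq_of_ne hne.symm, Finsupp.single_eq_of_ne hne.symm]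
      simp

theorem homogeneousPart_mem (b : Finset V → ℕ) (n : ℕ) (c : Finset V →₀ k[X]) :
    homogeneousPart k b n c ∈ homogeneousChains k b n := by
  intro σ m h
  rw [coeff_homogeneousPart] at h
  exact (ite_ne_right_iff.1 h).1

theorem homogeneousPart_of_mem {b : Finset V → ℕ} {m : ℕ} {c : Finset V →₀ k[X]}
    (hc : c ∈ homogeneousChains k b m) (n : ℕ) :
    homogeneousPart k b n c = if m = n then c else 0 := by
  ext σ j
  rw [coeff_homogeneousPart]
  by_cases h : (c σ).coeff j = 0
  · split_ifs <;> simp [h]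
  · have := hc σ j h
    subst this
    split_ifs <;> simp

theorem homogeneousPart_mem_supported (b : Finset V → ℕ) (n : ℕ) {s : Set (Finset V)}
    {c : Finset V →₀ k[X]} (hc : c ∈ Finsupp.supported k[X] k[X] s) :
    homogeneousPart k b n c ∈ Finsupp.supported k[X] k[X] s := by
  rw [Finsupp.mem_supported'] at hc ⊢
  intro σ hσ
  ext m
  simp [coeff_homogeneousPart, hc σ hσ]

theorem single_monomial_mem_homogeneousChains (b : Finset V → ℕ) (σ : Finset V) (m : ℕ) (a : k) :
    Finsupp.single σ (monomial m a) ∈ homogeneousChains k b (b σ + m) := by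
  intro τ j h
  rcases eq_or_ne σ τ with rfl | hne
  · rw [Finsupp.single_eq_same, coeff_monomial] at h
    rw [(ite_ne_right_iff.1 h).1]
  · rw [Finsupp.single_eq_of_ne hne.symm] at h
    simp at h

variable [LinearOrder V]

/-- The augmented boundary map on chains of arbitrary finite sets, where the generator `σ` has
degree `b σ`; the empty set is allowed as a face. -/
noncomputable def augBoundary (k : Type*) [Field k] (b : Finset V → ℕ) :
    (Finset V →₀ k[X]) →ₗ[k[X]] (Finset V →₀ k[X]) :=
  Finsupp.linearCombination k[X] fun σ => ∑ v ∈ σ,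
    Finsupp.single (σ.erase v) ((-1) ^ position σ v * X ^ (b σ - b (σ.erase v)))

theorem augBoundary_single (b : Finset V → ℕ) (σ : Finset V) (r : k[X]) :
    augBoundary k b (Finsupp.single σ r) = ∑ v ∈ σ, Finsupp.single (σ.erase v)
      (r * ((-1) ^ position σ v * X ^ (b σ - b (σ.erase v)))) := by
  simp only [augBoundary, Finsupp.linearCombination_single, Finset.smul_sum, Finsupp.smul_single,
    smul_eq_mul]

theorem augBoundary_mem_supported (b : Finset V → ℕ) {s t : Set (Finset V)}
    (hst : ∀ σ ∈ s, ∀ v ∈ σ, σ.erase v ∈ t) {c : Finset V →₀ k[X]}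
    (hc : c ∈ Finsupp.supported k[X] k[X] s) :
    augBoundary k b c ∈ Finsupp.supported k[X] k[X] t := by
  induction hc using supported_induction with
  | h0 => simp
  | hadd c _ d _ hc hd => rw [map_add]; exact add_mem hc hd
  | hsingle σ hσ r =>
    rw [augBoundary_single]
    exact sum_mem fun v hv => Finsupp.single_mem_supported _ _ (hst σ hσ v hv)

/-- `S` is closed under passing to subsets and the degree `b` is monotone on `S`. -/
def IsGradedLowerSet (S : Set (Finset V)) (b : Finset V → ℕ) : Prop :=
  ∀ σ ∈ S, ∀ τ ⊆ σ, τ ∈ S ∧ b τ ≤ b σ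

/-- Removing `v` then `w` and removing `w` then `v` give the same face with opposite signs.
Monotonicity of `b` on `S` makes the truncated differences in the exponents add up, so the powers of
t agree as well. -/
theorem augBoundary_augBoundary {S : Set (Finset V)} {b : Finset V → ℕ}
    (hS : IsGradedLowerSet S b) {c : Finset V →₀ k[X]}
    (hc : c ∈ Finsupp.supported k[X] k[X] S) : augBoundary k b (augBoundary k b c) = 0 := by
  induction hc using supported_induction with
  | h0 => simp
  | hadd c _ d _ hc hd => rw [map_add, map_add, hc, hd, add_zero]
  | hsingle σ hσ r =>
    have hterm : ∀ v ∈ σ, augBoundary k b (Finsupp.single (σ.erase v)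
        (r * ((-1) ^ position σ v * X ^ (b σ - b (σ.erase v))))) =
        ∑ w ∈ σ.erase v, Finsupp.single ((σ.erase v).erase w)
          (r * ((-1) ^ (position σ v + position (σ.erase v) w) *
            X ^ (b σ - b ((σ.erase v).erase w)))) := by
      intro v hv
      rw [augBoundary_single]
      refine Finset.sum_congr rfl fun w hw => ?_
      have h1 := hS σ hσ _ (Finset.erase_subset v σ)
      have h2 := (hS _ h1.1 _ (Finset.erase_subset w _)).2
      have h3 : b σ - b ((σ.erase v).erase w) =
        (b σ - b (σ.erase v)) + (b (σ.erase v) - b ((σ.erase v).erase w)) := by omega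
      rw [h3, pow_add, pow_add]
      congr 1
      ring
    rw [augBoundary_single, map_sum, Finset.sum_congr rfl hterm, Finset.sum_sigma']
    refine Finset.sum_involution (fun a _ => ⟨a.2, a.1⟩) ?_ ?_ ?_ ?_
    · rintro ⟨v, w⟩ h
      simp only [Finset.mem_sigma, Finset.mem_erase] at h
      obtain ⟨hv, hne, hw⟩ := h
      simp only [Finset.erase_right_comm (a := w) (b := v)]
      rw [← Finsupp.single_add, ← mul_add, ← add_mul]
      have hsign : ((-1 : k[X]) ^ (position σ v + position (σ.erase v) w) +
          (-1) ^ (position σ w + position (σ.erase w) v)) = 0 := by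
        rcases lt_or_gt_of_ne hne with h | h
        · rw [position_erase_of_le h.le, ← position_erase_of_lt hw h]
          ring
        · rw [position_erase_of_le h.le, ← position_erase_of_lt hv h]
          ring
      rw [hsign, zero_mul, mul_zero, Finsupp.single_zero]
    · rintro ⟨v, w⟩ h - heq
      simp only [Finset.mem_sigma, Finset.mem_erase] at h
      exact h.2.1 (congrArg Sigma.fst heq)
    · rintro ⟨v, w⟩ h
      simp only [Finset.mem_sigma, Finset.mem_erase] at h ⊢
      exact ⟨h.2.2, h.2.1.symm, h.1⟩
    · rintro ⟨v, w⟩ -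
      rfl

/-- The powers of t make the boundary homogeneous of degree 0, provided that faces have no larger
degree. This is what later allows fillings to be replaced by homogeneous ones. -/
theorem homogeneousPart_augBoundary {S : Set (Finset V)} {b : Finset V → ℕ}
    (hS : IsGradedLowerSet S b) (n : ℕ) {c : Finset V →₀ k[X]}
    (hc : c ∈ Finsupp.supported k[X] k[X] S) :
    homogeneousPart k b n (augBoundary k b c) = augBoundary k b (homogeneousPart k b n c) := by
  induction hc using supported_induction with
  | h0 => simp
  | hadd c _ d _ hc hd => rw [map_add, map_add, map_add, map_add, hc, hd]
  | hsingle σ hσ r =>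
    induction r using Polynomial.induction_on' with
    | add p q hp hq => rw [Finsupp.single_add, map_add, map_add, map_add, map_add, hp, hq]
    | monomial m a =>
      have hmem : augBoundary k b (Finsupp.single σ (monomial m a)) ∈
          homogeneousChains k b (b σ + m) := by
        rw [augBoundary_single]
        refine sum_mem fun v _ => ?_
        have hle := (hS σ hσ _ (Finset.erase_subset v σ)).2
        have hcoef : (monomial m a : k[X]) * ((-1) ^ position σ v * X ^ (b σ - b (σ.erase v))) =
            monomial (m + (b σ - b (σ.erase v))) (a * (-1) ^ position σ v) := by
          rw [← C_mul_X_pow_eq_monomial, ← C_mul_X_pow_eq_monomial]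
          simp only [map_mul, map_pow, map_neg, map_one]
          ring
        rw [hcoef, show b σ + m = b (σ.erase v) + (m + (b σ - b (σ.erase v))) by omega]
        exact single_monomial_mem_homogeneousChains b _ _ _
      rw [homogeneousPart_of_mem hmem, homogeneousPart_of_mem
        (single_monomial_mem_homogeneousChains b σ m a)]
      split_ifs <;> simp

/-- Every cycle of the augmented chain complex on `S` is a boundary. -/
def AugExact (k : Type*) [Field k] (S : Set (Finset V)) (b : Finset V → ℕ) : Prop :=
  ∀ (s : ℕ), ∀ c ∈ Finsupp.supported k[X] k[X] {σ : Finset V | σ ∈ S ∧ σ.card = s},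
    augBoundary k b c = 0 →
      ∃ w ∈ Finsupp.supported k[X] k[X] {σ : Finset V | σ ∈ S ∧ σ.card = s + 1},
        augBoundary k b w = c

/-- The cone operator with apex `a`. -/
noncomputable def coneMap (k : Type*) [Field k] (a : V) :
    (Finset V →₀ k[X]) →ₗ[k[X]] (Finset V →₀ k[X]) :=
  Finsupp.linearCombination k[X] fun σ =>
    if a ∈ σ then 0 else Finsupp.single (insert a σ) ((-1) ^ position (insert a σ) a)

theorem coneMap_single_of_mem {a : V} {σ : Finset V} (h : a ∈ σ) (r : k[X]) :
    coneMap k a (Finsupp.single σ r) = 0 := by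
  simp [coneMap, h]

theorem coneMap_single_of_notMem {a : V} {σ : Finset V} (h : a ∉ σ) (r : k[X]) :
    coneMap k a (Finsupp.single σ r) =
      Finsupp.single (insert a σ) (r * (-1) ^ position (insert a σ) a) := by
  simp [coneMap, h]

/-- The cone operator is a contracting homotopy. Adding the apex does not change degrees, so no
power of t obstructs the identity. -/
theorem augBoundary_coneMap_add {S : Set (Finset V)} {b : Finset V → ℕ} {a : V}
    (hS : IsGradedLowerSet S b) (hb : ∀ σ ∈ S, b (insert a σ) = b σ)
    {c : Finset V →₀ k[X]} (hc : c ∈ Finsupp.supported k[X] k[X] S) :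
    augBoundary k b (coneMap k a c) + coneMap k a (augBoundary k b c) = c := by
  induction hc using supported_induction with
  | h0 => simp
  | hadd c _ d _ hc hd =>
    simp only [map_add]
    nth_rewrite 3 [← hc]
    nth_rewrite 3 [← hd]
    abel
  | hsingle σ hσ r =>
    by_cases ha : a ∈ σ
    · rw [coneMap_single_of_mem ha, map_zero, zero_add, augBoundary_single, map_sum,
        Finset.sum_eq_single_of_mem a ha]
      · have h1 := hb _ (hS σ hσ _ (Finset.erase_subset a σ)).1
        rw [coneMap_single_of_notMem (Finset.notMem_erase a σ)]
        rw [Finset.insert_erase ha] at h1 ⊢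
        rw [← h1, Nat.sub_self, pow_zero, mul_one, mul_assoc, ← mul_pow]
        simp
      · intro v _ hne
        exact coneMap_single_of_mem (Finset.mem_erase.2 ⟨hne.symm, ha⟩) _
    · rw [coneMap_single_of_notMem ha, augBoundary_single, Finset.sum_insert ha,
        augBoundary_single, map_sum, add_assoc, ← Finset.sum_add_distrib]
      -- Only the face opposite the apex survives: for each `v` in `σ` the two orders of inserting
      -- `a` and removing `v` cancel.
      have hzero : ∀ v ∈ σ, Finsupp.single ((insert a σ).erase v)
            (r * (-1) ^ position (insert a σ) a *
              ((-1) ^ position (insert a σ) v * X ^ (b (insert a σ) - b ((insert a σ).erase v)))) +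
          coneMap k a (Finsupp.single (σ.erase v)
            (r * ((-1) ^ position σ v * X ^ (b σ - b (σ.erase v))))) = 0 := by
        intro v hv
        have hne : v ≠ a := fun h => ha (h ▸ hv)
        have hins : insert a (σ.erase v) = (insert a σ).erase v :=
          (Finset.erase_insert_of_ne hne.symm).symm
        rw [coneMap_single_of_notMem fun h => ha (Finset.mem_of_mem_erase h), hins,
          ← Finsupp.single_add, hb σ hσ, ← hins,
          hb _ (hS σ hσ _ (Finset.erase_subset v σ)).1, hins]
        have hera : (insert a σ).erase a = σ := Finset.erase_insert ha
        have hv' : v ∈ insert a σ := Finset.mem_insert_of_mem hv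
        have hsign : ((-1 : k[X]) ^ (position (insert a σ) a + position (insert a σ) v) +
            (-1) ^ (position σ v + position ((insert a σ).erase v) a)) = 0 := by
          rcases lt_or_gt_of_ne hne with h | h
          · have h1 := position_erase_of_le (σ := insert a σ) h.le
            have h2 := position_erase_of_lt hv' h
            rw [hera] at h1
            rw [h1, ← h2]
            ring
          · have h1 := position_erase_of_lt (Finset.mem_insert_self a σ) h
            have h2 := position_erase_of_le (σ := insert a σ) h.le
            rw [hera] at h1
            rw [h2, ← h1]
            ring
        rw [Finsupp.single_eq_zero]
        linear_combination r * X ^ (b σ - b (σ.erase v)) * hsign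
      rw [Finset.sum_eq_zero hzero, add_zero, Finset.erase_insert ha, hb σ hσ, Nat.sub_self,
        pow_zero, mul_one, mul_assoc, ← mul_pow]
      simp

theorem augExact_of_cone {S : Set (Finset V)} {b : Finset V → ℕ} (a : V)
    (hS : IsGradedLowerSet S b) (hb : ∀ σ ∈ S, insert a σ ∈ S ∧ b (insert a σ) = b σ) :
    AugExact k S b := by
  intro s c hc hz
  refine ⟨coneMap k a c, ?_, ?_⟩
  · clear hz
    induction hc using supported_induction with
    | h0 => simp
    | hadd c _ d _ hc hd => rw [map_add]; exact add_mem hc hd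
    | hsingle σ hσ r =>
      by_cases ha : a ∈ σ
      · rw [coneMap_single_of_mem ha]
        exact zero_mem _
      · rw [coneMap_single_of_notMem ha]
        refine Finsupp.single_mem_supported _ _ ⟨(hb σ hσ.1).1, ?_⟩
        rw [Finset.card_insert_of_notMem ha, hσ.2]
  · have h := augBoundary_coneMap_add (a := a) hS (fun σ hσ => (hb σ hσ).2)
      (Finsupp.supported_mono (fun σ hσ => hσ.1) hc)
    rwa [hz, map_zero, add_zero] at h

end AugmentedBoundary

/-! ### Joins with a fixed outer set, and pushing chains into a full subcomplex -/

section Join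

theorem mapDomain_mem_supported {V W k : Type*} [Field k] {s : Set (Finset V)} {t : Set (Finset W)}
    {g : Finset V → Finset W} (hst : ∀ σ ∈ s, g σ ∈ t) {c : Finset V →₀ k[X]}
    (hc : c ∈ Finsupp.supported k[X] k[X] s) :
    c.mapDomain g ∈ Finsupp.supported k[X] k[X] t := by
  induction hc using supported_induction with
  | h0 => simp
  | hadd c _ d _ hc hd => rw [Finsupp.mapDomain_add]; exact add_mem hc hd
  | hsingle σ hσ r =>
    rw [Finsupp.mapDomain_single]
    exact Finsupp.single_mem_supported _ _ (hst σ hσ)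

variable {V W : Type*} [LinearOrder V] [LinearOrder W]

/-- The union of the image of a finite set with a fixed finite set. -/
def joinMap (f : V ↪o W) (J : Finset W) (σ : Finset V) : Finset W :=
  σ.map f.toEmbedding ∪ J

open Classical in
/-- The part of a finite set outside the range of `f`. -/
noncomputable def outerPart (f : V ↪o W) (τ : Finset W) : Finset W :=
  τ.filter (· ∉ Set.range f)

variable {f : V ↪o W} {J : Finset W}

theorem disjoint_map_of_outer (hJ : ∀ v, f v ∉ J) (σ : Finset V) :
    Disjoint (σ.map f.toEmbedding) J := by
  rw [Finset.disjoint_left]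
  intro x hx
  obtain ⟨v, _, rfl⟩ := Finset.mem_map.1 hx
  exact hJ v

theorem joinMap_injective (hJ : ∀ v, f v ∉ J) : Function.Injective (joinMap f J) := by
  intro σ τ h
  refine Finset.map_injective f.toEmbedding ?_
  rw [← Finset.union_sdiff_cancel_right (disjoint_map_of_outer hJ σ),
    ← Finset.union_sdiff_cancel_right (disjoint_map_of_outer hJ τ)]
  exact congrArg (· \ J) h

theorem joinMap_mono {σ τ : Finset V} (h : τ ⊆ σ) : joinMap f J τ ⊆ joinMap f J σ :=
  Finset.union_subset_union_left (Finset.map_subset_map.2 h)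

theorem card_joinMap (hJ : ∀ v, f v ∉ J) (σ : Finset V) :
    (joinMap f J σ).card = σ.card + J.card := by
  rw [joinMap, Finset.card_union_of_disjoint (disjoint_map_of_outer hJ σ), Finset.card_map]

theorem joinMap_erase (hJ : ∀ v, f v ∉ J) (σ : Finset V) (v : V) :
    (joinMap f J σ).erase (f v) = joinMap f J (σ.erase v) := by
  rw [joinMap, Finset.erase_union_distrib, Finset.erase_eq_of_notMem (hJ v), joinMap,
    Finset.map_erase]
  rfl

/-- If the second summand does not depend on `v`, joining with `J` changes all these boundary signs
by one common factor. -/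
theorem position_joinMap (hJ : ∀ v, f v ∉ J) (σ : Finset V) (v : V) :
    position (joinMap f J σ) (f v) = position σ v + position J (f v) := by
  unfold position joinMap
  rw [Finset.filter_union, Finset.card_union_of_disjoint
    (Finset.disjoint_filter_filter (disjoint_map_of_outer hJ σ)), Finset.filter_map,
    Finset.card_map]
  congr 2
  ext x
  simp

theorem outerPart_joinMap (hJ : ∀ v, f v ∉ J) (σ : Finset V) :
    outerPart f (joinMap f J σ) = J := by
  ext x
  simp only [outerPart, joinMap, Finset.mem_filter, Finset.mem_union, Finset.mem_map, Set.mem_range]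
  constructor
  · rintro ⟨⟨v, _, rfl⟩ | h, hx⟩
    · exact absurd ⟨v, rfl⟩ hx
    · exact h
  · rintro h
    exact ⟨Or.inr h, fun ⟨v, hv⟩ => hJ v (hv ▸ h)⟩

theorem outerPart_subset (f : V ↪o W) (τ : Finset W) : outerPart f τ ⊆ τ := by
  classical exact Finset.filter_subset _ _

theorem outerPart_mono (f : V ↪o W) {σ τ : Finset W} (h : σ ⊆ τ) :
    outerPart f σ ⊆ outerPart f τ := by
  classical exact Finset.filter_subset_filter _ h

theorem notMem_outerPart (f : V ↪o W) (τ : Finset W) (v : V) : f v ∉ outerPart f τ := by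
  simp [outerPart]

theorem exists_joinMap_outerPart (f : V ↪o W) (τ : Finset W) :
    ∃ σ, joinMap f (outerPart f τ) σ = τ := by
  refine ⟨τ.preimage f f.injective.injOn, ?_⟩
  ext x
  simp only [outerPart, joinMap, Finset.mem_filter, Finset.mem_union, Finset.mem_map, Set.mem_range,
    Finset.mem_preimage]
  constructor
  · rintro (⟨v, h, rfl⟩ | h)
    · exact h
    · exact h.1
  · intro h
    by_cases hx : ∃ v, f v = x
    · obtain ⟨v, rfl⟩ := hx
      exact Or.inl ⟨v, h, rfl⟩
    · exact Or.inr ⟨h, hx⟩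

variable {k : Type*} [Field k]

/-- Up to terms with smaller outer part and up to sign, joining with `J` commutes with the
boundary. -/
theorem augBoundary_mapDomain_joinMap_sub (b : Finset W → ℕ) (hJ : ∀ v, f v ∉ J) {e : ℕ}
    (he : ∀ v, position J (f v) = e) (c : Finset V →₀ k[X]) :
    augBoundary k b (c.mapDomain (joinMap f J)) -
      (-1 : k[X]) ^ e • (augBoundary k (b ∘ joinMap f J) c).mapDomain (joinMap f J) ∈
    Finsupp.supported k[X] k[X] {τ : Finset W | outerPart f τ ⊂ J} := by
  induction c using Finsupp.induction_linear with
  | zero => simp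
  | add c d hc hd =>
    rw [Finsupp.mapDomain_add, map_add, map_add, Finsupp.mapDomain_add, smul_add, add_sub_add_comm]
    exact add_mem hc hd
  | single σ r =>
    rw [Finsupp.mapDomain_single, augBoundary_single, augBoundary_single,
      Finsupp.mapDomain_finsetSum, Finset.smul_sum]
    nth_rewrite 1 [joinMap]
    -- Removing a vertex `f v` reproduces the boundary of `σ` up to the common sign; removing a
    -- vertex of `J` strictly shrinks the outer part and goes into the error term.
    rw [Finset.sum_union (disjoint_map_of_outer hJ σ), Finset.sum_map, add_sub_right_comm,
      ← Finset.sum_sub_distrib, Finset.sum_eq_zero, zero_add]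
    · refine sum_mem fun x hx => Finsupp.single_mem_supported _ _ ?_
      have hsub : outerPart f ((joinMap f J σ).erase x) ⊆ J :=
        (outerPart_mono f (Finset.erase_subset _ _)).trans_eq (outerPart_joinMap hJ σ)
      refine Finset.ssubset_iff_subset_ne.2 ⟨hsub, fun h => ?_⟩
      rw [← h] at hx
      exact Finset.notMem_erase _ _ (outerPart_subset _ _ hx)
    · intro v _
      rw [Finsupp.mapDomain_single, sub_eq_zero]
      change Finsupp.single ((joinMap f J σ).erase (f v)) (r * ((-1) ^ position _ (f v) *
        X ^ (_ - b ((joinMap f J σ).erase (f v))))) = _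
      rw [joinMap_erase hJ, position_joinMap hJ, he, Finsupp.smul_single]
      simp only [Function.comp_apply, smul_eq_mul]
      congr 1
      ring

theorem augBoundary_mapDomain_map (b : Finset W → ℕ) (c : Finset V →₀ k[X]) :
    augBoundary k b (c.mapDomain (joinMap f ∅)) =
      (augBoundary k (b ∘ joinMap f ∅) c).mapDomain (joinMap f ∅) := by
  have h := augBoundary_mapDomain_joinMap_sub (f := f) (J := ∅) b (by simp) (e := 0)
    (by simp [position]) c
  simpa [Finset.not_ssubset_empty, sub_eq_zero] using h

/-- The chains supported on joins with `J` are the images of chains. -/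
theorem exists_mapDomain_joinMap {s : Set (Finset W)} (hs : ∀ τ ∈ s, outerPart f τ = J)
    {z : Finset W →₀ k[X]} (hz : z ∈ Finsupp.supported k[X] k[X] s) :
    ∃ c ∈ Finsupp.supported k[X] k[X] (joinMap f J ⁻¹' s), c.mapDomain (joinMap f J) = z := by
  have himage : joinMap f J '' (joinMap f J ⁻¹' s) = s := by
    rw [Set.image_preimage_eq_iff]
    intro τ hτ
    rw [← hs τ hτ]
    exact exists_joinMap_outerPart f τ
  rw [← himage, ← Finsupp.lmapDomain_supported] at hz
  exact hz

/-- Outer finite sets have a constant sign and augmented exact links. -/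
def HasExactLinks (k : Type*) [Field k] (S : Set (Finset W)) (b : Finset W → ℕ) (f : V ↪o W) :
    Prop :=
  ∀ J ∈ S, J.Nonempty → (∀ v, f v ∉ J) → (∃ e, ∀ v, position J (f v) = e) ∧
    AugExact k (joinMap f J ⁻¹' S) (b ∘ joinMap f J)

/-- The chain `z` is the join of `J` with a chain in the link of `J`. The hypothesis on the boundary
makes that chain a cycle; a filling of it, joined with `J` again, removes `z` up to smaller outer
parts. -/
theorem exists_sub_augBoundary_outerPart_ssubset {S : Set (Finset W)} {b : Finset W → ℕ}
    (hlink : HasExactLinks k S b f) (hS : IsGradedLowerSet S b) (hne : J.Nonempty) {q : ℕ}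
    {z : Finset W →₀ k[X]} (hz : z ∈ Finsupp.supported k[X] k[X]
      {τ : Finset W | (τ ∈ S ∧ τ.card = q) ∧ outerPart f τ = J})
    (hbd : ∀ τ, outerPart f τ = J → augBoundary k b z τ = 0) :
    ∃ w ∈ Finsupp.supported k[X] k[X] {τ : Finset W | τ ∈ S ∧ τ.card = q + 1},
      z - augBoundary k b w ∈ Finsupp.supported k[X] k[X] {τ : Finset W | outerPart f τ ⊂ J} := by
  -- For nonzero `z`, a simplex of the support shows that `J` lies in `S`, avoids the range of `f`
  -- and has at most `q` elements, so that `q - J.card` below is not truncated.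
  rcases eq_or_ne z 0 with rfl | hz0
  · exact ⟨0, zero_mem _, by simp⟩
  obtain ⟨τ, hτ⟩ := Finsupp.support_nonempty_iff.2 hz0
  obtain ⟨⟨hτS, hτq⟩, rfl⟩ := hz hτ
  set J := outerPart f τ
  have hJ : ∀ v, f v ∉ J := notMem_outerPart f τ
  have hle : J.card ≤ q := hτq ▸ Finset.card_le_card (outerPart_subset f τ)
  obtain ⟨⟨e, he⟩, hexact⟩ := hlink J (hS τ hτS _ (outerPart_subset f τ)).1 hne hJ
  have hsign : ∀ c : Finset W →₀ k[X], (-1 : k[X]) ^ e • (-1 : k[X]) ^ e • c = c := by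
    intro c
    rw [smul_smul, ← mul_pow]
    simp
  obtain ⟨c, hc, rfl⟩ := exists_mapDomain_joinMap (f := f) (fun τ hτ => hτ.2) hz
  have hcyc : augBoundary k (b ∘ joinMap f J) c = 0 := by
    ext1 σ
    have h := augBoundary_mapDomain_joinMap_sub b hJ he c
    rw [Finsupp.mem_supported'] at h
    have h1 := h (joinMap f J σ) (by simp [outerPart_joinMap hJ])
    rw [Finsupp.sub_apply, hbd _ (outerPart_joinMap hJ σ), zero_sub, neg_eq_zero,
      Finsupp.smul_apply, Finsupp.mapDomain_apply (joinMap_injective hJ)] at h1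
    simpa using h1
  obtain ⟨w, hw, hwc⟩ := hexact (q - J.card) c
    (Finsupp.supported_mono (fun σ hσ => by
      have h1 := card_joinMap hJ σ
      have h2 := hσ.1.2
      exact ⟨hσ.1.1, by omega⟩) hc) hcyc
  -- The factor compensates the sign that joining with `J` introduces in the boundary.
  refine ⟨(-1 : k[X]) ^ e • w.mapDomain (joinMap f J), Submodule.smul_mem _ _
    (mapDomain_mem_supported ?_ hw), ?_⟩
  · rintro σ ⟨hσ1, hσ2⟩
    refine ⟨hσ1, ?_⟩
    rw [card_joinMap hJ, hσ2]
    omega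
  · have h := augBoundary_mapDomain_joinMap_sub b hJ he w
    have h1 := Submodule.smul_mem _ (-(-1 : k[X]) ^ e) h
    rw [hwc, smul_sub, neg_smul, neg_smul, hsign, sub_neg_eq_add, neg_add_eq_sub] at h1
    rwa [map_smul]

/-- Induction on the bound for the sizes of outer parts. Passing to a face never enlarges the outer
part, so the components of `z` with distinct outer parts of the maximal size do not interact and can
be removed independently. -/
theorem exists_sub_augBoundary_outerPart_eq_empty {S : Set (Finset W)} {b : Finset W → ℕ}
    (hlink : HasExactLinks k S b f) (hS : IsGradedLowerSet S b) {q : ℕ} (m : ℕ) :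
    ∀ z ∈ Finsupp.supported k[X] k[X]
      {τ : Finset W | (τ ∈ S ∧ τ.card = q) ∧ (outerPart f τ).card ≤ m},
    augBoundary k b z ∈ Finsupp.supported k[X] k[X] {τ : Finset W | outerPart f τ = ∅} →
    ∃ w ∈ Finsupp.supported k[X] k[X] {τ : Finset W | τ ∈ S ∧ τ.card = q + 1},
      z - augBoundary k b w ∈ Finsupp.supported k[X] k[X] {τ : Finset W | outerPart f τ = ∅} := by
  induction m with
  | zero =>
    intro z hz _
    refine ⟨0, zero_mem _, ?_⟩
    rw [map_zero, sub_zero]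
    exact Finsupp.supported_mono (fun τ hτ => Finset.card_eq_zero.1 (Nat.le_zero.1 hτ.2)) hz
  | succ m ih =>
    intro z hz hbd
    classical
    have hzJ : ∀ (J : Finset W) (t : Set (Finset W)), (∀ τ ∈ z.support, outerPart f τ = J → τ ∈ t) →
        z.filter (fun τ => outerPart f τ = J) ∈ Finsupp.supported k[X] k[X] t := by
      intro J t h τ hτ
      rw [Finset.mem_coe, Finsupp.support_filter, Finset.mem_filter] at hτ
      exact h τ hτ.1 hτ.2
    have hex : ∀ J : Finset W, ∃ w ∈ Finsupp.supported k[X] k[X]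
        {τ : Finset W | τ ∈ S ∧ τ.card = q + 1}, J.card = m + 1 →
        z.filter (fun τ => outerPart f τ = J) - augBoundary k b w ∈
          Finsupp.supported k[X] k[X] {τ : Finset W | (outerPart f τ).card ≤ m} := by
      intro J
      by_cases hcard : J.card = m + 1
      swap
      · exact ⟨0, zero_mem _, fun h => absurd h hcard⟩
      have hne : J.Nonempty := Finset.card_pos.1 (by omega)
      -- Since `J` is nonempty, the boundary of `z` has no term with outer part `J`. The other
      -- components of `z` contribute none: a face with outer part `J` comes from a simplex whose
      -- outer part contains `J`, hence equals `J` by maximality of its size.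
      have hbdJ : ∀ τ, outerPart f τ = J →
          augBoundary k b (z.filter (fun τ => outerPart f τ = J)) τ = 0 := by
        intro τ hτ
        have hsplit := Finsupp.filter_add_filter_not z (fun τ => outerPart f τ = J)
        have h1 : augBoundary k b z τ = 0 :=
          (Finsupp.mem_supported' _ _).1 hbd τ fun h => by
            rw [← hτ, h] at hne
            exact Finset.not_nonempty_empty hne
        have h2 : augBoundary k b (z.filter (fun τ => ¬ outerPart f τ = J)) ∈
            Finsupp.supported k[X] k[X] {τ : Finset W | outerPart f τ ≠ J} := by
          refine augBoundary_mem_supported b (s := {τ | (outerPart f τ).card ≤ m + 1 ∧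
            outerPart f τ ≠ J}) ?_ ?_
          · rintro τ ⟨hτ1, hτ2⟩ v _ h
            have hsub := outerPart_mono f (Finset.erase_subset v τ)
            rw [h] at hsub
            exact hτ2 (Finset.eq_of_subset_of_card_le hsub (by omega)).symm
          · intro τ hτ
            rw [Finset.mem_coe, Finsupp.support_filter, Finset.mem_filter] at hτ
            exact ⟨(hz hτ.1).2, hτ.2⟩
        rw [Finsupp.mem_supported'] at h2
        have h3 := h2 τ (by simpa using hτ)
        rw [← hsplit, map_add, Finsupp.add_apply, h3, add_zero] at h1
        exact h1
      obtain ⟨w, hw, h⟩ := exists_sub_augBoundary_outerPart_ssubset (f := f) hlink hS hne (q := q)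
        (z := z.filter (fun τ => outerPart f τ = J))
        (hzJ J _ fun τ hτ h => ⟨(hz hτ).1, h⟩) hbdJ
      refine ⟨w, hw, fun _ => Finsupp.supported_mono (fun τ hτ => ?_) h⟩
      have := Finset.card_lt_card hτ
      change (outerPart f τ).card ≤ m
      omega
    choose w hw hwz using hex
    set K := (z.support.image (outerPart f)).filter (fun J => J.card = m + 1)
    set w₁ := ∑ J ∈ K, w J
    have hw₁ : w₁ ∈ Finsupp.supported k[X] k[X] {τ : Finset W | τ ∈ S ∧ τ.card = q + 1} :=
      sum_mem fun J _ => hw J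
    have hdecomp : z = ∑ J ∈ K, z.filter (fun τ => outerPart f τ = J) +
        z.filter (fun τ => (outerPart f τ).card ≤ m) := by
      ext1 τ
      rw [Finsupp.add_apply, Finsupp.finsetSum_apply]
      simp only [Finsupp.filter_apply]
      rw [Finset.sum_ite_eq]
      by_cases h0 : z τ = 0
      · simp [h0]
      · have hτ : τ ∈ z.support := Finsupp.mem_support_iff.2 h0
        have hle := (hz hτ).2
        have hK : outerPart f τ ∈ K ↔ (outerPart f τ).card = m + 1 := by
          rw [Finset.mem_filter]
          exact and_iff_right (Finset.mem_image_of_mem _ hτ)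
        simp only [hK]
        change (outerPart f τ).card ≤ m + 1 at hle
        split_ifs with h1 h2 h2
        · omega
        · simp
        · simp
        · omega
    have hsub : z - augBoundary k b w₁ ∈ Finsupp.supported k[X] k[X]
        {τ : Finset W | (τ ∈ S ∧ τ.card = q) ∧ (outerPart f τ).card ≤ m} := by
      rw [Set.ofPred_and, Finsupp.supported_inter]
      refine ⟨sub_mem (Finsupp.supported_mono (fun τ hτ => hτ.1) hz)
        (augBoundary_mem_supported b ?_ hw₁), ?_⟩
      · rintro τ ⟨hτ1, hτ2⟩ v hv
        refine ⟨(hS τ hτ1 _ (Finset.erase_subset v τ)).1, ?_⟩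
        rw [Finset.card_erase_of_mem hv, hτ2]
        omega
      · nth_rewrite 1 [hdecomp]
        rw [map_sum, add_sub_right_comm, ← Finset.sum_sub_distrib]
        refine add_mem (sum_mem fun J hJ => hwz J (Finset.mem_filter.1 hJ).2) ?_
        intro τ hτ
        rw [Finset.mem_coe, Finsupp.support_filter, Finset.mem_filter] at hτ
        exact hτ.2
    -- Subtracting a boundary leaves the boundary of `z` unchanged, so the induction hypothesis
    -- applies.
    obtain ⟨w₂, hw₂, h⟩ := ih _ hsub (by
      rwa [map_sub, augBoundary_augBoundary hS
        (Finsupp.supported_mono (fun τ hτ => hτ.1) hw₁), sub_zero])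
    refine ⟨w₁ + w₂, add_mem hw₁ hw₂, ?_⟩
    rwa [map_add, ← sub_sub]

/-- Chains whose boundary lies in the range of `f` can be pushed into the range of `f`. -/
theorem exists_sub_augBoundary_eq_mapDomain {S : Set (Finset W)} {b : Finset W → ℕ}
    (hlink : HasExactLinks k S b f) (hS : IsGradedLowerSet S b) {q : ℕ} {z : Finset W →₀ k[X]}
    (hz : z ∈ Finsupp.supported k[X] k[X] {τ : Finset W | τ ∈ S ∧ τ.card = q})
    (hbd : augBoundary k b z ∈ Finsupp.supported k[X] k[X] {τ : Finset W | outerPart f τ = ∅}) :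
    ∃ w ∈ Finsupp.supported k[X] k[X] {τ : Finset W | τ ∈ S ∧ τ.card = q + 1},
      z - augBoundary k b w ∈ Finsupp.supported k[X] k[X] {τ : Finset W | outerPart f τ = ∅} :=
  exists_sub_augBoundary_outerPart_eq_empty hlink hS q z
    (fun τ hτ => ⟨hz hτ, (hz hτ).2 ▸ Finset.card_le_card (outerPart_subset f τ)⟩) hbd

end Join

/-! ### From finite-set chains to persistent homology of a full subcomplex -/

section Comparison

/-- The filtration step at which a finite set enters a filtered complex. -/
noncomputable def step {V : Type*} (X : FilteredComplex V) (τ : Finset V) : ℕ :=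
  sInf {n | τ ∈ X n}

/-- The simplices of a filtered complex together with the empty set. -/
def faceSet {V : Type*} (X : FilteredComplex V) : Set (Finset V) :=
  {τ | τ = ∅ ∨ ∃ n, τ ∈ X n}

theorem mem_step {V : Type*} {X : FilteredComplex V} {τ : Finset V} {n : ℕ} (h : τ ∈ X n) :
    τ ∈ X (step X τ) :=
  Nat.sInf_mem (s := {n | τ ∈ X n}) ⟨n, h⟩

theorem step_le {V : Type*} {X : FilteredComplex V} {τ : Finset V} {n : ℕ} (h : τ ∈ X n) :
    step X τ ≤ n :=
  Nat.sInf_le h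

theorem nonempty_of_mem {V : Type*} {X : FilteredComplex V} {τ : Finset V} {n : ℕ}
    (h : τ ∈ X n) : τ.Nonempty :=
  ((X n).isRelLowerSet_faces h).1

theorem mem_of_subset {V : Type*} {X : FilteredComplex V} {σ τ : Finset V} {n : ℕ}
    (h : σ ∈ X n) (hsub : τ ⊆ σ) (hne : τ.Nonempty) : τ ∈ X n :=
  ((X n).isRelLowerSet_faces h).2 hsub hne

/-- The empty set is never a simplex, and the infimum of the empty set of natural numbers is 0. -/
theorem step_empty {V : Type*} (X : FilteredComplex V) : step X ∅ = 0 := by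
  rw [step, Nat.sInf_eq_zero]
  exact Or.inr (Set.eq_empty_of_forall_notMem fun n h =>
    Finset.not_nonempty_empty (nonempty_of_mem (X := X) h))

theorem isGradedLowerSet_faceSet {V : Type*} (X : FilteredComplex V) :
    IsGradedLowerSet (faceSet X) (step X) := by
  intro σ hσ τ hτ
  rcases τ.eq_empty_or_nonempty with rfl | hne
  · exact ⟨Or.inl rfl, by rw [step_empty]; exact Nat.zero_le _⟩
  · rcases hσ with rfl | ⟨n, hn⟩
    · exact absurd (Finset.subset_empty.1 hτ ▸ hne) Finset.not_nonempty_empty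
    · exact ⟨Or.inr ⟨n, mem_of_subset hn hτ hne⟩, step_le (mem_of_subset (mem_step hn) hτ hne)⟩

variable (k : Type*) [Field k] {V W : Type*}

/-- Simplicial chains as chains of arbitrary finite sets. -/
noncomputable def chainsInclusion (X : FilteredComplex V) (q : ℕ) :
    Chains k X q →ₗ[k[X]] (Finset V →₀ k[X]) :=
  Finsupp.lmapDomain k[X] k[X] fun σ : X.Simplex q => σ.1

theorem chainsInclusion_single (X : FilteredComplex V) (q : ℕ) (σ : X.Simplex q) (r : k[X]) :
    chainsInclusion k X q (Finsupp.single σ r) = Finsupp.single σ.1 r :=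
  Finsupp.mapDomain_single

theorem chainsInclusion_injective (X : FilteredComplex V) (q : ℕ) :
    Function.Injective (chainsInclusion k X q) :=
  Finsupp.mapDomain_injective Subtype.val_injective

theorem chainsInclusion_mem_supported (X : FilteredComplex V) (q : ℕ) (c : Chains k X q) :
    chainsInclusion k X q c ∈
      Finsupp.supported k[X] k[X] {τ : Finset V | τ ∈ faceSet X ∧ τ.card = q + 1} := by
  induction c using Finsupp.induction_linear with
  | zero => simp
  | add c d hc hd => rw [map_add]; exact add_mem hc hd
  | single σ r =>
    rw [chainsInclusion_single]
    exact Finsupp.single_mem_supported _ _ ⟨Or.inr σ.2.1, σ.2.2⟩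

theorem exists_chainsInclusion_eq (X : FilteredComplex V) (q : ℕ) {c : Finset V →₀ k[X]}
    (hc : c ∈ Finsupp.supported k[X] k[X] {τ : Finset V | τ ∈ faceSet X ∧ τ.card = q + 1}) :
    ∃ c', chainsInclusion k X q c' = c := by
  induction hc using supported_induction with
  | h0 => exact ⟨0, map_zero _⟩
  | hadd c _ d _ hc hd =>
    obtain ⟨c', rfl⟩ := hc
    obtain ⟨d', rfl⟩ := hd
    exact ⟨c' + d', map_add _ _ _⟩
  | hsingle σ hσ r =>
    obtain ⟨rfl | h, hcard⟩ := hσ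
    · simp at hcard
    · exact ⟨Finsupp.single ⟨σ, h, hcard⟩ r, chainsInclusion_single k X q _ r⟩

theorem mem_chainsDegree_iff (X : FilteredComplex V) (q n : ℕ) (c : Chains k X q) :
    c ∈ chainsDegree k X q n ↔ chainsInclusion k X q c ∈ homogeneousChains k (step X) n := by
  constructor
  · intro h
    induction h using Submodule.span_induction with
    | mem c hc =>
      obtain ⟨σ, m, rfl, rfl⟩ := hc
      rw [chainsInclusion_single, ← monomial_one_right_eq_X_pow]
      exact single_monomial_mem_homogeneousChains _ _ _ _
    | zero => simp
    | add c d _ _ hc hd => rw [map_add]; exact add_mem hc hd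
    | smul a c _ hc =>
      rw [LinearMap.map_smul_of_tower]
      exact Submodule.smul_mem _ a hc
  · intro h
    rw [← Finsupp.sum_single c]
    refine sum_mem fun σ _ => ?_
    have hσ : chainsInclusion k X q c σ.1 = c σ :=
      Finsupp.mapDomain_apply Subtype.val_injective c σ
    rw [(c σ).as_sum_support, ← Finsupp.singleAddHom_apply, map_sum]
    refine sum_mem fun m hm => ?_
    rw [Finsupp.singleAddHom_apply, ← mul_one ((c σ).coeff m), ← smul_eq_mul, ← smul_monomial,
      monomial_one_right_eq_X_pow, ← Finsupp.smul_single]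
    refine Submodule.smul_mem _ _ (Submodule.subset_span ⟨σ, m, ?_, rfl⟩)
    exact h σ.1 m (by rw [hσ]; exact mem_support_iff.1 hm)

variable [LinearOrder V] [LinearOrder W]

/-- The simplicial boundary meets only nonempty faces, so `b ∅` is left free. In the link of `J` the
empty set carries the degree of `J`, not the default value of `step`. -/
theorem chainsInclusion_boundary {X : FilteredComplex V} {b : Finset V → ℕ}
    (hb : ∀ n, ∀ τ ∈ X n, b τ = step X τ) (q : ℕ) (c : Chains k X (q + 1)) :
    chainsInclusion k X q (boundary k X q c) =
      augBoundary k b (chainsInclusion k X (q + 1) c) := by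
  induction c using Finsupp.induction_linear with
  | zero => simp
  | add c d hc hd => rw [map_add, map_add, map_add, map_add, hc, hd]
  | single σ r =>
    rw [chainsInclusion_single, augBoundary_single, boundary, Finsupp.linearCombination_single,
      map_smul, boundarySimplex, map_sum, Finset.smul_sum, ← Finset.sum_attach σ.1]
    refine Finset.sum_congr rfl fun v _ => ?_
    rw [chainsInclusion_single, Finsupp.smul_single, smul_eq_mul]
    obtain ⟨n, hn⟩ := σ.2.1
    obtain ⟨m, hm⟩ := (face σ v.1 v.2).2.1
    rw [hb n _ hn, hb m (σ.1.erase v.1) hm]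
    rfl

theorem chainsInclusion_boundary_step (X : FilteredComplex V) (q : ℕ) (c : Chains k X (q + 1)) :
    chainsInclusion k X q (boundary k X q c) =
      augBoundary k (step X) (chainsInclusion k X (q + 1) c) :=
  chainsInclusion_boundary k (fun _ _ _ => rfl) q c

/-- In dimension 0 every chain counts as a cycle, yet its augmentation may be nonzero. The empty set
has empty outer part, so the pushing argument covers this case too. -/
theorem augBoundary_chainsInclusion_of_mem_cycles (X : FilteredComplex V) (q : ℕ)
    {c : Chains k X q} (hc : c ∈ cycles k X q) :
    augBoundary k (step X) (chainsInclusion k X q c) ∈ Finsupp.supported k[X] k[X] {∅} := by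
  cases q with
  | zero =>
    refine augBoundary_mem_supported _ ?_ (chainsInclusion_mem_supported k X 0 c)
    rintro σ ⟨_, hσ⟩ v hv
    rw [Set.mem_singleton_iff, ← Finset.card_eq_zero, Finset.card_erase_of_mem hv, hσ]
  | succ q =>
    rw [← chainsInclusion_boundary_step, LinearMap.mem_ker.1 hc, map_zero]
    exact zero_mem _

variable {k} {X : FilteredComplex V} {Z : FilteredComplex W} {f : V ↪o W}

theorem step_comp_joinMap (hX : ∀ n σ, σ ∈ X n ↔ joinMap f ∅ σ ∈ Z n) :
    step Z ∘ joinMap f ∅ = step X := by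
  funext σ
  simp only [step, Function.comp_apply, hX]

/-- The inclusion of the simplices of a full subcomplex. -/
def simplexMap (hX : ∀ n σ, σ ∈ X n ↔ joinMap f ∅ σ ∈ Z n) (q : ℕ) (σ : X.Simplex q) :
    Z.Simplex q :=
  ⟨joinMap f ∅ σ.1, σ.2.1.imp fun n h => (hX n _).1 h, by
    rw [card_joinMap (by simp), Finset.card_empty, σ.2.2]⟩

/-- The inclusion of the chains of a full subcomplex. -/
noncomputable def chainsMap (k : Type*) [Field k] (hX : ∀ n σ, σ ∈ X n ↔ joinMap f ∅ σ ∈ Z n)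
    (q : ℕ) : Chains k X q →ₗ[k[X]] Chains k Z q :=
  Finsupp.lmapDomain k[X] k[X] (simplexMap hX q)

theorem chainsInclusion_chainsMap (hX : ∀ n σ, σ ∈ X n ↔ joinMap f ∅ σ ∈ Z n) (q : ℕ)
    (c : Chains k X q) : chainsInclusion k Z q (chainsMap k hX q c) =
      (chainsInclusion k X q c).mapDomain (joinMap f ∅) := by
  rw [chainsInclusion, chainsInclusion, chainsMap, Finsupp.lmapDomain_apply,
    Finsupp.lmapDomain_apply, Finsupp.lmapDomain_apply, ← Finsupp.mapDomain_comp,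
    ← Finsupp.mapDomain_comp]
  rfl

theorem chainsMap_injective (hX : ∀ n σ, σ ∈ X n ↔ joinMap f ∅ σ ∈ Z n) (q : ℕ) :
    Function.Injective (chainsMap k hX q) :=
  Finsupp.mapDomain_injective fun _ _ h =>
    Subtype.ext (joinMap_injective (by simp) (congrArg Subtype.val h))

theorem boundary_chainsMap (hX : ∀ n σ, σ ∈ X n ↔ joinMap f ∅ σ ∈ Z n) (q : ℕ)
    (c : Chains k X (q + 1)) :
    boundary k Z q (chainsMap k hX (q + 1) c) = chainsMap k hX q (boundary k X q c) := by
  apply chainsInclusion_injective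
  rw [chainsInclusion_boundary_step, chainsInclusion_chainsMap, chainsInclusion_chainsMap,
    augBoundary_mapDomain_map, step_comp_joinMap hX, chainsInclusion_boundary_step]

theorem chainsMap_mem_cycles_iff (hX : ∀ n σ, σ ∈ X n ↔ joinMap f ∅ σ ∈ Z n) (q : ℕ)
    (c : Chains k X q) : chainsMap k hX q c ∈ cycles k Z q ↔ c ∈ cycles k X q := by
  cases q with
  | zero => exact iff_of_true trivial trivial
  | succ q =>
    change boundary k Z q _ = 0 ↔ boundary k X q c = 0
    rw [boundary_chainsMap, map_eq_zero_iff _ (chainsMap_injective hX q)]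

theorem chainsMap_mem_chainsDegree_iff (hX : ∀ n σ, σ ∈ X n ↔ joinMap f ∅ σ ∈ Z n) (q n : ℕ)
    (c : Chains k X q) :
    chainsMap k hX q c ∈ chainsDegree k Z q n ↔ c ∈ chainsDegree k X q n := by
  have hinj : Function.Injective (joinMap f ∅) := joinMap_injective (by simp)
  rw [mem_chainsDegree_iff, mem_chainsDegree_iff, chainsInclusion_chainsMap,
    mem_homogeneousChains, mem_homogeneousChains, ← step_comp_joinMap hX]
  constructor
  · intro h σ m hm
    exact h (joinMap f ∅ σ) m (by rwa [Finsupp.mapDomain_apply hinj])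
  · intro h τ m hm
    by_cases hτ : τ ∈ Set.range (joinMap f ∅)
    · obtain ⟨σ, rfl⟩ := hτ
      rw [Finsupp.mapDomain_apply hinj] at hm
      exact h σ m hm
    · rw [Finsupp.mapDomain_of_notMem_range _ _ hτ] at hm
      simp at hm

theorem exists_chainsMap_eq (hX : ∀ n σ, σ ∈ X n ↔ joinMap f ∅ σ ∈ Z n) (q : ℕ)
    {z : Chains k Z q} (hz : chainsInclusion k Z q z ∈
      Finsupp.supported k[X] k[X] {τ : Finset W | outerPart f τ = ∅}) :
    ∃ x, chainsMap k hX q x = z := by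
  obtain ⟨c, hc, hcz⟩ := exists_mapDomain_joinMap (f := f) (J := ∅)
    (s := {τ | (τ ∈ faceSet Z ∧ τ.card = q + 1) ∧ outerPart f τ = ∅}) (fun τ hτ => hτ.2)
    fun τ hτ => ⟨chainsInclusion_mem_supported k Z q z hτ, hz hτ⟩
  obtain ⟨x, rfl⟩ := exists_chainsInclusion_eq k X q (c := c) <| by
    refine Finsupp.supported_mono ?_ hc
    rintro σ ⟨⟨h1, h2⟩, -⟩
    rw [card_joinMap (by simp), Finset.card_empty, add_zero] at h2
    refine ⟨Or.inr ?_, h2⟩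
    rcases h1 with h1 | ⟨n, hn⟩
    · have h3 := congrArg Finset.card h1
      rw [card_joinMap (by simp), Finset.card_empty, add_zero, h2] at h3
      omega
    · exact ⟨n, (hX n σ).2 hn⟩
  refine ⟨x, chainsInclusion_injective k Z q ?_⟩
  rw [chainsInclusion_chainsMap, hcz]

theorem exists_sub_boundary_eq_chainsMap (hX : ∀ n σ, σ ∈ X n ↔ joinMap f ∅ σ ∈ Z n)
    (hlink : HasExactLinks k (faceSet Z) (step Z) f) (q : ℕ) {z : Chains k Z q}
    (hz : augBoundary k (step Z) (chainsInclusion k Z q z) ∈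
      Finsupp.supported k[X] k[X] {τ : Finset W | outerPart f τ = ∅}) :
    ∃ w x, z - boundary k Z q w = chainsMap k hX q x ∧
      ∀ n, z ∈ chainsDegree k Z q n → ∃ w x, x ∈ chainsDegree k X q n ∧
        z - boundary k Z q w = chainsMap k hX q x := by
  obtain ⟨w, hw, hzw⟩ := exists_sub_augBoundary_eq_mapDomain hlink (isGradedLowerSet_faceSet Z)
    (chainsInclusion_mem_supported k Z q z) hz
  have hwS : w ∈ Finsupp.supported k[X] k[X] (faceSet Z) :=
    Finsupp.supported_mono (fun τ hτ => hτ.1) hw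
  -- This is used twice, for the filling `w` and for its part of degree `n`.
  have key : ∀ w ∈ Finsupp.supported k[X] k[X] {τ : Finset W | τ ∈ faceSet Z ∧ τ.card = q + 1 + 1},
      chainsInclusion k Z q z - augBoundary k (step Z) w ∈
        Finsupp.supported k[X] k[X] {τ : Finset W | outerPart f τ = ∅} →
      ∃ w' x, chainsInclusion k Z (q + 1) w' = w ∧
        z - boundary k Z q w' = chainsMap k hX q x := by
    intro w hw hzw
    obtain ⟨w', rfl⟩ := exists_chainsInclusion_eq k Z (q + 1) hw
    rw [← chainsInclusion_boundary_step, ← map_sub] at hzw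
    obtain ⟨x, hx⟩ := exists_chainsMap_eq hX q hzw
    exact ⟨w', x, rfl, hx.symm⟩
  obtain ⟨w', x, -, hx⟩ := key w hw hzw
  refine ⟨w', x, hx, fun n hn => ?_⟩
  rw [mem_chainsDegree_iff] at hn
  -- For `z` homogeneous of degree `n`, replacing `w` by its part of degree `n` gives the part of
  -- degree `n` of the difference, which is still supported in the subcomplex.
  have hpart : homogeneousPart k (step Z) n
      (chainsInclusion k Z q z - augBoundary k (step Z) w) =
      chainsInclusion k Z q z - augBoundary k (step Z) (homogeneousPart k (step Z) n w) := by
    rw [map_sub, homogeneousPart_of_mem hn, if_pos rfl,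
      homogeneousPart_augBoundary (isGradedLowerSet_faceSet Z) n hwS]
  obtain ⟨w', x, hw', hx⟩ := key _ (homogeneousPart_mem_supported (step Z) n hw)
    (hpart ▸ homogeneousPart_mem_supported (step Z) n hzw)
  refine ⟨w', x, ?_, hx⟩
  rw [← chainsMap_mem_chainsDegree_iff hX, ← hx, mem_chainsDegree_iff, map_sub,
    chainsInclusion_boundary_step, hw', ← hpart]
  exact homogeneousPart_mem _ _ _

theorem mem_homologyDegree_iff (X : FilteredComplex V) (q n : ℕ) (h : Homology k X q) :
    h ∈ homologyDegree k X q n ↔ ∃ c : cycles k X q, c.1 ∈ chainsDegree k X q n ∧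
      Submodule.Quotient.mk c = h :=
  Iff.rfl

/-- The map on homology induced by the inclusion of a full subcomplex. -/
noncomputable def homologyMap (k : Type*) [Field k] (hX : ∀ n σ, σ ∈ X n ↔ joinMap f ∅ σ ∈ Z n)
    (q : ℕ) : Homology k X q →ₗ[k[X]] Homology k Z q :=
  Submodule.mapQ _ _
    ((chainsMap k hX q).restrict fun c hc => (chainsMap_mem_cycles_iff hX q c).2 hc) <| by
      rintro c ⟨d, hd⟩
      refine ⟨chainsMap k hX (q + 1) d, ?_⟩
      rw [boundary_chainsMap, hd]
      rfl

theorem mk_eq_mk_iff (q : ℕ) (c d : cycles k X q) :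
    (Submodule.Quotient.mk c : Homology k X q) = Submodule.Quotient.mk d ↔
      ∃ w, boundary k X q w = c.1 - d.1 := by
  rw [Submodule.Quotient.eq]
  rfl

/-- The inclusion of a full subcomplex with exact links induces a graded isomorphism in persistent
homology. -/
theorem exists_homology_equiv (hX : ∀ n σ, σ ∈ X n ↔ joinMap f ∅ σ ∈ Z n)
    (hlink : HasExactLinks k (faceSet Z) (step Z) f) (q : ℕ) :
    ∃ e : Homology k X q ≃ₗ[k[X]] Homology k Z q, ∀ n h,
      h ∈ homologyDegree k X q n ↔ e h ∈ homologyDegree k Z q n := by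
  have hempty : ({∅} : Set (Finset W)) ⊆ {τ | outerPart f τ = ∅} := by
    rintro _ rfl
    exact Finset.subset_empty.1 (outerPart_subset f ∅)
  have hcyc : ∀ z : cycles k Z q, augBoundary k (step Z) (chainsInclusion k Z q z.1) ∈
      Finsupp.supported k[X] k[X] {τ : Finset W | outerPart f τ = ∅} := fun z =>
    Finsupp.supported_mono hempty (augBoundary_chainsInclusion_of_mem_cycles k Z q z.2)
  have hlift : ∀ (z : cycles k Z q) (w : Chains k Z (q + 1)) (x : Chains k X q),
      z.1 - boundary k Z q w = chainsMap k hX q x → ∃ hx : x ∈ cycles k X q,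
        homologyMap k hX q (Submodule.Quotient.mk ⟨x, hx⟩) = Submodule.Quotient.mk z := by
    intro z w x h
    have hx : x ∈ cycles k X q := by
      rw [← chainsMap_mem_cycles_iff hX, ← h]
      exact sub_mem z.2 (range_boundary_le_cycles k Z q ⟨w, rfl⟩)
    refine ⟨hx, Eq.symm ((mk_eq_mk_iff q _ _).2 ⟨w, ?_⟩)⟩
    change _ = z.1 - chainsMap k hX q x
    rw [← h, sub_sub_cancel]
  have hinj : Function.Injective (homologyMap k hX q) := by
    rw [injective_iff_map_eq_zero]
    intro h h0
    obtain ⟨c, rfl⟩ := Submodule.Quotient.mk_surjective _ h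
    obtain ⟨z, hz⟩ := (mk_eq_mk_iff q _ (0 : cycles k Z q)).1 h0
    change _ = chainsMap k hX q c.1 - 0 at hz
    rw [sub_zero] at hz
    -- If a cycle of `X` bounds `z` in `Z`, then `z` has its boundary in the subcomplex. Pushing `z`
    -- inside preserves that boundary and gives a filling in `X`.
    obtain ⟨w, x, hx, -⟩ := exists_sub_boundary_eq_chainsMap hX hlink (q + 1) (z := z) (by
      rw [← chainsInclusion_boundary_step, hz, chainsInclusion_chainsMap]
      exact mapDomain_mem_supported (s := Set.univ)
        (fun σ _ => outerPart_joinMap (by simp) σ) (by simp))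
    refine (mk_eq_mk_iff q c 0).2 ⟨x, chainsMap_injective hX q ?_⟩
    rw [← boundary_chainsMap, ← hx, map_sub, hz]
    have := LinearMap.congr_fun (boundary_comp_boundary k Z q) w
    rw [LinearMap.comp_apply, LinearMap.zero_apply] at this
    rw [this]
    simp
  have hsurj : Function.Surjective (homologyMap k hX q) := by
    intro h
    obtain ⟨z, rfl⟩ := Submodule.Quotient.mk_surjective _ h
    obtain ⟨w, x, hx, -⟩ := exists_sub_boundary_eq_chainsMap hX hlink q (hcyc z)
    obtain ⟨hx', h⟩ := hlift z w x hx
    exact ⟨_, h⟩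
  refine ⟨LinearEquiv.ofBijective (homologyMap k hX q) ⟨hinj, hsurj⟩, fun n h => ?_⟩
  change h ∈ homologyDegree k X q n ↔ homologyMap k hX q h ∈ homologyDegree k Z q n
  rw [mem_homologyDegree_iff, mem_homologyDegree_iff]
  constructor
  · rintro ⟨c, hc, rfl⟩
    exact ⟨⟨chainsMap k hX q c.1, (chainsMap_mem_cycles_iff hX q _).2 c.2⟩,
      (chainsMap_mem_chainsDegree_iff hX q n c.1).2 hc, rfl⟩
  · rintro ⟨z, hz, hzh⟩
    obtain ⟨-, -, -, hgr⟩ := exists_sub_boundary_eq_chainsMap hX hlink q (hcyc z)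
    obtain ⟨w, x, hxn, hx⟩ := hgr n hz
    obtain ⟨hx', h'⟩ := hlift z w x hx
    exact ⟨⟨x, hx'⟩, hxn, hinj (h'.trans hzh)⟩

end Comparison

/-! ### Persistent acyclicity gives an exact augmented complex -/

section Acyclic

variable {k : Type*} [Field k] {V : Type*} [LinearOrder V]

/-- The augmented chain complex of a persistently acyclic filtered complex is exact. -/
theorem augExact_of_persistentlyAcyclic {L : FilteredComplex V} (hL : PersistentlyAcyclic k L)
    {b : Finset V → ℕ} (hS : IsGradedLowerSet (faceSet L) b)
    (hb : ∀ n, ∀ τ ∈ L n, b τ = step L τ) {v₀ : V} (hv₀ : {v₀} ∈ faceSet L)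
    (hbv₀ : b {v₀} = b ∅) : AugExact k (faceSet L) b := by
  -- The vertex has the degree of the empty set, so its augmentation carries no power of t. This
  -- makes the augmentation surjective.
  have hv₀D : ∀ r : k[X],
      augBoundary k b (Finsupp.single {v₀} r) = Finsupp.single ∅ r := by
    intro r
    rw [augBoundary_single, Finset.sum_singleton]
    have h1 : ({v₀} : Finset V).erase v₀ = ∅ := by simp
    have h2 : position {v₀} v₀ = 0 := by simp [position, Finset.filter_singleton]
    rw [h1, h2, hbv₀]
    simp
  intro s c hc hcyc
  match s with
  | 0 =>
    refine ⟨Finsupp.single {v₀} (c ∅), Finsupp.single_mem_supported _ _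
      ⟨hv₀, Finset.card_singleton v₀⟩, ?_⟩
    rw [hv₀D]
    ext1 σ
    by_cases hσ : σ = ∅
    · simp [hσ]
    · rw [Finsupp.single_eq_of_ne hσ]
      exact ((Finsupp.mem_supported' _ _).1 hc σ fun h => hσ (Finset.card_eq_zero.1 h.2)).symm
  | 1 =>
    obtain ⟨c, rfl⟩ := exists_chainsInclusion_eq k L 0 hc
    let ε : Chains k L 0 →ₗ[k[X]] k[X] :=
      Finsupp.lapply ∅ ∘ₗ augBoundary k b ∘ₗ chainsInclusion k L 0
    have hle : (LinearMap.range (boundary k L 0)).submoduleOf (cycles k L 0) ≤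
        LinearMap.ker (ε ∘ₗ (cycles k L 0).subtype) := by
      rintro x ⟨d, hd⟩
      rw [LinearMap.mem_ker]
      change augBoundary k b (chainsInclusion k L 0 x.1) ∅ = 0
      change boundary k L 0 d = x.1 at hd
      rw [← hd, chainsInclusion_boundary k hb, augBoundary_augBoundary hS
        (Finsupp.supported_mono (fun σ hσ => hσ.1) (chainsInclusion_mem_supported k L 1 d))]
      rfl
    let ε' : Homology k L 0 →ₗ[k[X]] k[X] := Submodule.liftQ _ _ hle
    obtain ⟨⟨β, -⟩, -⟩ := hL
    let B : Homology k L 0 ≃ₗ[k[X]] k[X] :=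
      β.repr ≪≫ₗ Finsupp.uniqueLinearEquiv k[X] k[X] ()
    have hsurj : Function.Surjective (ε' ∘ₗ B.symm.toLinearMap) := by
      rw [LinearMap.coe_comp]
      refine Function.Surjective.comp ?_ B.symm.surjective
      intro r
      obtain ⟨x, hx⟩ := exists_chainsInclusion_eq k L 0 (c := Finsupp.single {v₀} r)
        (Finsupp.single_mem_supported _ _ ⟨hv₀, Finset.card_singleton v₀⟩)
      refine ⟨Submodule.Quotient.mk ⟨x, trivial⟩, ?_⟩
      change augBoundary k b (chainsInclusion k L 0 x) ∅ = r
      rw [hx, hv₀D, Finsupp.single_eq_same]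
    -- With `H₀` identified with k[t] through the basis, the augmentation is a surjective
    -- endomorphism of a Noetherian module, hence injective; thus a 0-chain of augmentation zero is
    -- a boundary.
    have hinj : Function.Injective (ε' ∘ₗ B.symm.toLinearMap) :=
      IsNoetherian.injective_of_surjective_endomorphism _ hsurj
    have hinj' : Function.Injective ε' := by
      intro x y hxy
      apply B.injective
      apply hinj
      simpa using hxy
    have h0 : (Submodule.Quotient.mk ⟨c, trivial⟩ : Homology k L 0) = 0 := by
      apply hinj'
      rw [map_zero]
      change augBoundary k b (chainsInclusion k L 0 c) ∅ = 0
      rw [hcyc, Finsupp.zero_apply]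
    obtain ⟨w, hw⟩ := (mk_eq_mk_iff 0 ⟨c, trivial⟩ (0 : cycles k L 0)).1 h0
    refine ⟨_, chainsInclusion_mem_supported k L 1 w, ?_⟩
    rw [← chainsInclusion_boundary k hb, hw]
    simp
  | q + 2 =>
    obtain ⟨c, rfl⟩ := exists_chainsInclusion_eq k L (q + 1) hc
    have hc' : c ∈ cycles k L (q + 1) := by
      refine LinearMap.mem_ker.2 (chainsInclusion_injective k L q ?_)
      rw [chainsInclusion_boundary k hb, hcyc, map_zero]
    have := hL.2 q
    obtain ⟨w, hw⟩ := (mk_eq_mk_iff (q + 1) ⟨c, hc'⟩ (0 : cycles k L (q + 1))).1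
      (Subsingleton.elim _ _)
    refine ⟨_, chainsInclusion_mem_supported k L (q + 2) w, ?_⟩
    rw [← chainsInclusion_boundary k hb, hw]
    simp

end Acyclic

/-! ### The blowup complex and its two families of links -/

section Blowup

variable {V I : Type*}

/-- The filtered complex on the disjoint union of the vertices and the index set which joins every
simplex `σ` with every `J` such that `σ` lies in all `U j`, `j ∈ J`. -/
def blowup (U : I → FilteredComplex V) : FilteredComplex (V ⊕ₗ I) where
  toFun n :=
    { faces := {τ | τ.Nonempty ∧ ∃ (σ : Finset V) (J : Finset I), σ.Nonempty ∧ J.Nonempty ∧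
        (∀ j ∈ J, σ ∈ U j n) ∧ (∀ v, Sum.inlₗ v ∈ τ → v ∈ σ) ∧ ∀ j, Sum.inrₗ j ∈ τ → j ∈ J}
      isRelLowerSet_faces := by
        rintro τ ⟨hτ, σ, J, hσ, hJ, hU, h1, h2⟩
        exact ⟨hτ, fun τ' hτ' hne => ⟨hne, σ, J, hσ, hJ, hU, fun v hv => h1 v (hτ' hv),
          fun j hj => h2 j (hτ' hj)⟩⟩ }
  monotone' := by
    rintro m n hmn τ ⟨hτ, σ, J, hσ, hJ, hU, h⟩
    exact ⟨hτ, σ, J, hσ, hJ, fun j hj => (U j).monotone hmn (hU j hj), h⟩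

theorem mem_blowup {U : I → FilteredComplex V} {n : ℕ} {τ : Finset (V ⊕ₗ I)} :
    τ ∈ blowup U n ↔ τ.Nonempty ∧ ∃ (σ : Finset V) (J : Finset I), σ.Nonempty ∧ J.Nonempty ∧
      (∀ j ∈ J, σ ∈ U j n) ∧ (∀ v, Sum.inlₗ v ∈ τ → v ∈ σ) ∧ ∀ j, Sum.inrₗ j ∈ τ → j ∈ J :=
  Iff.rfl

variable [LinearOrder V] [LinearOrder I]

/-- The inclusion of the vertices. -/
def inlEmbedding (V I : Type*) [LinearOrder V] [LinearOrder I] : V ↪o V ⊕ₗ I where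
  toFun := Sum.inlₗ
  inj' := Sum.inl_injective
  map_rel_iff' := Sum.Lex.inl_le_inl_iff

/-- The inclusion of the indices. -/
def inrEmbedding (V I : Type*) [LinearOrder V] [LinearOrder I] : I ↪o V ⊕ₗ I where
  toFun := Sum.inrₗ
  inj' := Sum.inr_injective
  map_rel_iff' := Sum.Lex.inr_le_inr_iff

/-- The disjoint union of a set of vertices and a set of indices. -/
def cell (σ : Finset V) (J : Finset I) : Finset (V ⊕ₗ I) :=
  σ.map (inlEmbedding V I).toEmbedding ∪ J.map (inrEmbedding V I).toEmbedding

theorem inl_mem_cell {σ : Finset V} {J : Finset I} {v : V} : Sum.inlₗ v ∈ cell σ J ↔ v ∈ σ := by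
  simp only [cell, Finset.mem_union, Finset.mem_map]
  constructor
  · rintro (⟨w, hw, h⟩ | ⟨j, _, h⟩)
    · exact Sum.inl_injective h ▸ hw
    · exact absurd h Sum.inr_ne_inl
  · exact fun h => Or.inl ⟨v, h, rfl⟩

theorem inr_mem_cell {σ : Finset V} {J : Finset I} {j : I} : Sum.inrₗ j ∈ cell σ J ↔ j ∈ J := by
  simp only [cell, Finset.mem_union, Finset.mem_map]
  constructor
  · rintro (⟨v, _, h⟩ | ⟨i, hi, h⟩)
    · exact absurd h Sum.inl_ne_inr
    · exact Sum.inr_injective h ▸ hi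
  · exact fun h => Or.inr ⟨j, h, rfl⟩

theorem joinMap_inl (σ : Finset V) (J : Finset I) :
    joinMap (inlEmbedding V I) (J.map (inrEmbedding V I).toEmbedding) σ = cell σ J :=
  rfl

theorem joinMap_inr (σ : Finset V) (J : Finset I) :
    joinMap (inrEmbedding V I) (σ.map (inlEmbedding V I).toEmbedding) J = cell σ J :=
  Finset.union_comm _ _

theorem eq_map_inr {τ : Finset (V ⊕ₗ I)} (h : ∀ v, inlEmbedding V I v ∉ τ) :
    ∃ J : Finset I, τ = J.map (inrEmbedding V I).toEmbedding := by
  refine ⟨τ.preimage (inrEmbedding V I) (inrEmbedding V I).injective.injOn, ?_⟩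
  ext x
  simp only [Finset.mem_map, Finset.mem_preimage]
  constructor
  · intro hx
    rcases x with v | j
    · exact absurd hx (h v)
    · exact ⟨j, hx, rfl⟩
  · rintro ⟨j, hj, rfl⟩
    exact hj

theorem eq_map_inl {τ : Finset (V ⊕ₗ I)} (h : ∀ j, inrEmbedding V I j ∉ τ) :
    ∃ σ : Finset V, τ = σ.map (inlEmbedding V I).toEmbedding := by
  refine ⟨τ.preimage (inlEmbedding V I) (inlEmbedding V I).injective.injOn, ?_⟩
  ext x
  simp only [Finset.mem_map, Finset.mem_preimage]
  constructor
  · intro hx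
    rcases x with v | j
    · exact ⟨v, hx, rfl⟩
    · exact absurd hx (h j)
  · rintro ⟨v, hv, rfl⟩
    exact hv

theorem cell_nonempty_left {σ : Finset V} (hσ : σ.Nonempty) (J : Finset I) :
    (cell σ J).Nonempty :=
  ⟨Sum.inlₗ hσ.choose, inl_mem_cell.2 hσ.choose_spec⟩

theorem cell_nonempty_right (σ : Finset V) {J : Finset I} (hJ : J.Nonempty) :
    (cell σ J).Nonempty :=
  ⟨Sum.inrₗ hJ.choose, inr_mem_cell.2 hJ.choose_spec⟩

variable {U : I → FilteredComplex V} {n : ℕ} {σ : Finset V} {J : Finset I}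

theorem cell_mem_blowup (hσ : σ.Nonempty) (hJ : J.Nonempty) :
    cell σ J ∈ blowup U n ↔ ∀ j ∈ J, σ ∈ U j n := by
  rw [mem_blowup]
  constructor
  · rintro ⟨-, σ', J', -, -, hU, h1, h2⟩ j hj
    exact mem_of_subset (hU j (h2 j (inr_mem_cell.2 hj))) (fun v hv => h1 v (inl_mem_cell.2 hv)) hσ
  · intro h
    exact ⟨cell_nonempty_right σ hJ, σ, J, hσ, hJ, h, fun _ => inl_mem_cell.1,
      fun _ => inr_mem_cell.1⟩

/-- The witness `J` in the blowup is nonempty, which forces `σ` into some member of the cover; this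
recovers `X` once the cover is used. -/
theorem cell_empty_right_mem_blowup : cell σ (∅ : Finset I) ∈ blowup U n ↔ ∃ i, σ ∈ U i n := by
  constructor
  · rintro ⟨⟨x, hx⟩, σ', J', -, ⟨j, hj⟩, hU, h1, -⟩
    refine ⟨j, mem_of_subset (hU j hj) (fun v hv => h1 v (inl_mem_cell.2 hv)) ?_⟩
    rcases x with v | i
    · exact ⟨v, inl_mem_cell.1 hx⟩
    · exact absurd (inr_mem_cell.1 hx) (Finset.notMem_empty i)
  · rintro ⟨i, hi⟩
    have hσ := nonempty_of_mem hi
    refine mem_of_subset ((cell_mem_blowup hσ (Finset.singleton_nonempty i)).2 (by simpa using hi))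
      (Finset.union_subset_union_right (by simp)) (cell_nonempty_left hσ ∅)

theorem cell_empty_left_mem_blowup : cell (∅ : Finset V) J ∈ blowup U n ↔ J ∈ nerve U n := by
  constructor
  · rintro ⟨⟨x, hx⟩, σ', J', -, -, hU, -, h2⟩
    have hJ : J.Nonempty := by
      rcases x with v | i
      · exact absurd (inl_mem_cell.1 hx) (Finset.notMem_empty v)
      · exact ⟨i, inr_mem_cell.1 hx⟩
    exact ⟨hJ, σ', (mem_inter U hJ n σ').2 fun j hj => hU j (h2 j (inr_mem_cell.2 hj))⟩
  · rintro ⟨hJ, σ', hσ'⟩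
    refine mem_of_subset ((cell_mem_blowup (nonempty_of_mem hσ') hJ).2
      ((mem_inter U hJ n σ').1 hσ')) (Finset.union_subset_union_left (by simp))
      (cell_nonempty_right ∅ hJ)

theorem isGradedLowerSet_joinMap {W W' : Type*} [LinearOrder W] [LinearOrder W']
    {S : Set (Finset W)} {b : Finset W → ℕ} (hS : IsGradedLowerSet S b) (f : W' ↪o W)
    (J : Finset W) : IsGradedLowerSet (joinMap f J ⁻¹' S) (b ∘ joinMap f J) :=
  fun _ hσ _ hτ => hS _ hσ _ (joinMap_mono hτ)

/-- The link of `J` is the intersection of the `U j` with the same births on simplices, the empty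
set having the degree at which `J` enters the nerve. All signs agree because `V` precedes `I` in the
lexicographic order. -/
theorem hasExactLinks_inl {k : Type*} [Field k]
    (hacyclic : ∀ J : Finset I, J.Nonempty → (∃ (n : ℕ) (σ : Finset V), σ ∈ inter U J n) →
      PersistentlyAcyclic k (inter U J)) :
    HasExactLinks k (faceSet (blowup U)) (step (blowup U)) (inlEmbedding V I) := by
  intro J' hJ' hne hout
  obtain ⟨J, rfl⟩ := eq_map_inr hout
  have hJ : J.Nonempty := Finset.map_nonempty.1 hne
  refine ⟨⟨0, fun v => ?_⟩, ?_⟩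
  · rw [position, Finset.card_eq_zero, Finset.filter_eq_empty_iff]
    intro x hx
    obtain ⟨j, _, rfl⟩ := Finset.mem_map.1 hx
    exact Sum.Lex.not_inr_lt_inl
  have hmem : ∀ (n : ℕ) (σ : Finset V), σ.Nonempty →
      (cell σ J ∈ blowup U n ↔ σ ∈ inter U J n) := by
    intro n σ hσ
    rw [cell_mem_blowup hσ hJ, mem_inter U hJ]
  have hnil : cell (∅ : Finset V) J ∈ faceSet (blowup U) := by
    rw [← joinMap_inl]
    simpa [joinMap] using hJ'
  have hS : joinMap (inlEmbedding V I) (J.map (inrEmbedding V I).toEmbedding) ⁻¹'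
      faceSet (blowup U) = faceSet (inter U J) := by
    ext σ
    rcases σ.eq_empty_or_nonempty with rfl | hσ
    · exact iff_of_true hnil (Or.inl rfl)
    · exact or_congr (iff_of_false (cell_nonempty_left hσ J).ne_empty hσ.ne_empty)
        (exists_congr fun n => hmem n σ hσ)
  have hlow := isGradedLowerSet_joinMap (isGradedLowerSet_faceSet (blowup U)) (inlEmbedding V I)
    (J.map (inrEmbedding V I).toEmbedding)
  rw [hS] at hlow ⊢
  obtain ⟨n, hn⟩ := hnil.resolve_left (cell_nonempty_right ∅ hJ).ne_empty
  -- At the step when `J` enters the nerve, the intersection already has a simplex. Any vertex of it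
  -- has the same degree in the link as the empty set.
  obtain ⟨-, σ, hσ⟩ := cell_empty_left_mem_blowup.1 (mem_step hn)
  obtain ⟨v, hv⟩ := nonempty_of_mem hσ
  have hvmem := mem_of_subset hσ (Finset.singleton_subset_iff.2 hv) (Finset.singleton_nonempty v)
  have hvface : {v} ∈ faceSet (inter U J) := Or.inr ⟨_, hvmem⟩
  refine augExact_of_persistentlyAcyclic (hacyclic J hJ ⟨_, σ, hσ⟩) hlow ?_ hvface
    (le_antisymm (step_le ((hmem _ _ (Finset.singleton_nonempty v)).2 hvmem))
      (hlow _ hvface _ (Finset.empty_subset _)).2)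
  intro n τ hτ
  have hset : ∀ m, cell τ J ∈ blowup U m ↔ τ ∈ inter U J m := fun m =>
    hmem m τ (nonempty_of_mem hτ)
  change sInf {m | cell τ J ∈ blowup U m} = sInf {m | τ ∈ inter U J m}
  simp only [hset]

/-- An index whose member contains `σ` at the birth of `σ` can be added to any simplex of the link
without delaying its birth, so the link is a cone. No acyclicity is needed here. -/
theorem hasExactLinks_inr (k : Type*) [Field k] (U : I → FilteredComplex V) :
    HasExactLinks k (faceSet (blowup U)) (step (blowup U)) (inrEmbedding V I) := by
  intro σ' hσ' hne hout
  obtain ⟨σ, rfl⟩ := eq_map_inl hout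
  have hσ : σ.Nonempty := Finset.map_nonempty.1 hne
  refine ⟨⟨σ.card, fun i => ?_⟩, ?_⟩
  · rw [position, Finset.filter_true_of_mem, Finset.card_map]
    intro x hx
    obtain ⟨v, _, rfl⟩ := Finset.mem_map.1 hx
    exact Sum.Lex.inl_lt_inr v i
  have hnil : cell σ (∅ : Finset I) ∈ faceSet (blowup U) := by
    simpa [cell] using hσ'
  obtain ⟨n, hn⟩ := hnil.resolve_left (cell_nonempty_left hσ ∅).ne_empty
  -- The apex must be chosen at the first step of `σ`: a simplex of the blowup containing `σ` is
  -- born no earlier, and by then `σ` lies in `U i`.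
  obtain ⟨i, hi⟩ := cell_empty_right_mem_blowup.1 (mem_step hn)
  have hins : ∀ (J : Finset I) (m : ℕ), cell σ J ∈ blowup U m ↔ cell σ (insert i J) ∈ blowup U m := by
    intro J m
    constructor
    · intro h
      have h0 : cell σ (∅ : Finset I) ∈ blowup U m := mem_of_subset h
        (Finset.union_subset_union_right (by simp)) (cell_nonempty_left hσ ∅)
      have him : σ ∈ U i m := (U i).monotone (step_le h0) hi
      rw [cell_mem_blowup hσ (Finset.insert_nonempty i J)]
      intro j hj
      rcases Finset.mem_insert.1 hj with rfl | hj
      · exact him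
      · exact (cell_mem_blowup hσ ⟨j, hj⟩).1 h j hj
    · intro h
      exact mem_of_subset h (Finset.union_subset_union_right (Finset.map_subset_map.2
        (Finset.subset_insert i J))) (cell_nonempty_left hσ J)
  refine augExact_of_cone i
    (isGradedLowerSet_joinMap (isGradedLowerSet_faceSet (blowup U)) _ _) ?_
  intro J hJ
  rw [Set.mem_preimage, joinMap_inr] at hJ
  rw [Set.mem_preimage, Function.comp_apply, Function.comp_apply, joinMap_inr, joinMap_inr]
  refine ⟨Or.inr ?_, ?_⟩
  · obtain ⟨m, hm⟩ := hJ.resolve_left (cell_nonempty_left hσ J).ne_empty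
    exact ⟨m, (hins J m).1 hm⟩
  · simp only [step, hins J]

end Blowup

end FilteredComplex

theorem mainTheorem2 {k : Type*} [Field k] {V I : Type*} [LinearOrder V] [LinearOrder I]
    (X : FilteredComplex V) (U : I → FilteredComplex V) (hcover : X = ⨆ i, U i)
    (hacyclic : ∀ J : Finset I, J.Nonempty →
      (∃ (n : ℕ) (σ : Finset V), σ ∈ FilteredComplex.inter U J n) →
      FilteredComplex.PersistentlyAcyclic k (FilteredComplex.inter U J))
    (q : ℕ) :
    ∃ e : FilteredComplex.Homology k X q ≃ₗ[Polynomial k]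
        FilteredComplex.Homology k (FilteredComplex.nerve U) q,
      ∀ (n : ℕ) (h : FilteredComplex.Homology k X q),
        h ∈ FilteredComplex.homologyDegree k X q n ↔
          e h ∈ FilteredComplex.homologyDegree k (FilteredComplex.nerve U) q n := by
  open FilteredComplex in
  have hX : ∀ n σ, σ ∈ X n ↔ joinMap (inlEmbedding V I) ∅ σ ∈ blowup U n := by
    intro n σ
    rw [hcover, mem_iSup, ← cell_empty_right_mem_blowup]
    rfl
  have hN : ∀ n J, J ∈ nerve U n ↔ joinMap (inrEmbedding V I) ∅ J ∈ blowup U n := by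
    intro n J
    rw [← cell_empty_left_mem_blowup, ← joinMap_inr]
    rfl
  obtain ⟨e₁, h₁⟩ := exists_homology_equiv (k := k) hX (hasExactLinks_inl hacyclic) q
  obtain ⟨e₂, h₂⟩ := exists_homology_equiv (k := k) hN (hasExactLinks_inr k U) q
  refine ⟨e₁ ≪≫ₗ e₂.symm, fun n h => ?_⟩
  rw [h₁, h₂, LinearEquiv.trans_apply, LinearEquiv.apply_symm_apply]
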